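/- A $\mathbb{Q}$-weighted automaton $\mathcal{A} = (Q, \Sigma, M, \alpha, \eta)$ consists of a finite set of states $Q$, a finite alphabet $\Sigma$, a map $M : \Sigma \to \mathbb{Q}^{Q \times Q}$, an initial row vector $\alpha \in \mathbb{Q}^Q$ and a final column vector $\eta \in \mathbb{Q}^Q$. Its language is the map $L_{\mathcal{A}} : \Sigma^* \to \mathbb{Q}$ with $L_{\mathcal{A}}(a_1 \cdots a_k) = \alpha M(a_1) \cdots M(a_k) \eta$ (so $L_{\mathcal{A}}(\varepsilon) = \alpha \eta$). The automaton is called image-binary if $L_{\mathcal{A}}(w) \in \{0,1\}$ for all $w \in \Sigma^*$. Theorem. Given a $\mathbb{Q}$-weighted automaton, one can decide in polynomial time whether it is image-binary. That is, there are a (multi-stack) Turing machine and a polynomial $p$ such that, for every $\mathbb{Q}$-weighted automaton $\mathcal{A}$, the machine started on the encoding of $\mathcal{A}$ of length $\ell$ halts after at most $p(\ell)$ steps with the correct answer to the question whether $\mathcal{A}$ is image-binary. Here $Q = \{0,\dots,n-1\}$ and $\Sigma = \{0,\dots,m-1\}$, and the encoding lists $n$ and $m$ in unary, followed by all entries of $\alpha$,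 of $\eta$ and of the matrices $M(a)$, $a \in \Sigma$, as reduced fractions with numerators and denominators in binary. -/

import Mathlib

/-- An `F`-weighted automaton `(Q, S, M, α, η)` with set of states `Q` and alphabet `S`: a transition
matrix `M a` for every letter `a`, an initial (row) vector `α` and a final (column) vector `η`. -/
structure WeightedAutomaton (F Q S : Type*) where
  /-- the transition matrices -/
  M : S → Matrix Q Q F
  /-- the initial vector -/
  α : Q → F
  /-- the final vector -/
  η : Q → F

namespace WeightedAutomaton

variable {F Q S : Type*} [Semiring F] [Fintype Q] [DecidableEq Q]

/-- `M(a₁ ⋯ aₖ) = M(a₁) ⋯ M(aₖ)`; the empty word has the identity matrix. -/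
def wordMatrix (A : WeightedAutomaton F Q S) (w : List S) : Matrix Q Q F :=
  (w.map A.M).prod

/-- The language `L_A(w) = α M(w) η`. -/
def language (A : WeightedAutomaton F Q S) (w : List S) : F :=
  Matrix.vecMul A.α (A.wordMatrix w) ⬝ᵥ A.η

/-- `A` is image-binary if `L_A(w) ∈ {0, 1}` for all words `w`. -/
def IsImageBinary (A : WeightedAutomaton F Q S) : Prop :=
  ∀ w : List S, A.language w = 0 ∨ A.language w = 1

end WeightedAutomaton

/-- A `ℚ`-weighted automaton as the input of an algorithm: the numbers `n` of states and `m` of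
letters, together with an automaton with states `0, …, n - 1` and letters `0, …, m - 1`. -/
structure RatAutomaton where
  /-- the number of states -/
  n : ℕ
  /-- the number of letters -/
  m : ℕ
  /-- the automaton itself -/
  aut : WeightedAutomaton ℚ (Fin n) (Fin m)

namespace RatAutomaton

/-- The finite alphabet in which automata are written down. -/
inductive Sym where
  | bit (b : Bool)
  | minus
  | slash
  | comma
  deriving DecidableEq, Fintype

/-- A natural number in unary, followed by a comma. -/
def encodeUnary (k : ℕ) : List Sym :=
  List.replicate k (Sym.bit true) ++ [Sym.comma]

/-- The digits of a natural number in binary, least significant bit first (none for `0`). -/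
def encodeBinary (k : ℕ) : List Sym :=
  (Computability.encodeNat k).map Sym.bit

/-- A rational number, written as a reduced fraction with numerator and denominator in binary,
with a minus sign in front if it is negative, and followed by a comma. -/
def encodeRat (q : ℚ) : List Sym :=
  (if q < 0 then [Sym.minus] else []) ++ encodeBinary q.num.natAbs ++ [Sym.slash] ++
    encodeBinary q.den ++ [Sym.comma]

/-- A vector, entry by entry. -/
def encodeVec {n : ℕ} (v : Fin n → ℚ) : List Sym :=
  (List.ofFn fun i => encodeRat (v i)).flatten

/-- A square matrix, row by row. -/
def encodeMat {n : ℕ} (B : Matrix (Fin n) (Fin n) ℚ) : List Sym :=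
  (List.ofFn fun i => encodeVec (B i)).flatten

/-- An automaton written as a string: the numbers of states and of letters in unary, the initial
vector, the final vector, and the transition matrices of all letters. -/
def encode (A : RatAutomaton) : List Sym :=
  encodeUnary A.n ++ encodeUnary A.m ++ encodeVec A.aut.α ++ encodeVec A.aut.η ++
    (List.ofFn fun a => encodeMat (A.aut.M a)).flatten

end RatAutomaton

/-! An automaton is image-binary iff L(w)(L(w) - 1) = 0 for every word w. Writing x = M(w)η, this
quantity is linear in the pair (x xᵀ, x), which lives in a space of dimension n² + n and is
transformed linearly by each letter. The spans of the pairs coming from words of length at most k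
form a chain that stabilises by the step equal to the dimension, so words of length at most n² + n
decide the question (`forall_eq_zero_of_short`, `WeightedAutomaton.isImageBinary_iff_short`).

There are exponentially many such words, but one integer tests them all, without Gaussian
elimination. Clear denominators by a common D > 0 and add a state of weight D, so that with p = (α,
0), q = (α, -D) and u = (η, D), now integral, the numbers p·x_w and q·x_w are equal positive
multiples of L(w) and L(w) - 1. Then (p·x_w)²(q·x_w)² is the pairing of p⊗q⊗p⊗q with the fourth
Kronecker power of x_w. Iterating c + Σ_a B(a)^⊗4 with c > 0, starting at u^⊗4, gives a combination
with positive coefficients of these powers in which every short word occurs. Its pairing with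
p⊗q⊗p⊗q is a sum of nonnegative terms, hence zero iff each term is (`exists_dot_iterate`,
`dot_iterateStep_eq_zero_iff`, `core_eq_true_iff`). The ℓ¹ norm grows by at most a fixed factor per
iteration, so bit lengths grow linearly in the number of iterations.

For the machine, structured stack programs with a cost semantics are compiled to `TM2`
(`StackProg.Exec.compile`). Data are binary trees on one stack, and `PolyTime` is closed under
composition, pairing, branching and folds whose intermediate values stay polynomially large
(`PolyTime.foldl`). Every function of the algorithm is assembled from these closure properties. -/

open Turing Function

/-! ### Structured programs on stacks and their compilation to `TM2` machines -/

/-- Structured programs operating on stacks, where stack `k` has the alphabet `Γ k`. -/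
inductive StackProg {K : Type} (Γ : K → Type) : Type
  /-- do nothing -/
  | skip : StackProg Γ
  /-- push a symbol -/
  | push (k : K) (x : Γ k) : StackProg Γ
  /-- run two programs one after the other -/
  | seq (p q : StackProg Γ) : StackProg Γ
  /-- pop a symbol and branch on it -/
  | case (k : K) (p : Option (Γ k) → StackProg Γ) : StackProg Γ
  /-- pop symbols and run a program for each of them until the stack is empty -/
  | loop (k : K) (p : Γ k → StackProg Γ) : StackProg Γ

namespace StackProg

variable {K : Type} [DecidableEq K] {Γ : K → Type}

/-- `Exec p s n s'`: started with stacks `s`, the program `p` stops with stacks `s'` after at most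
`n` steps. -/
inductive Exec : StackProg Γ → (∀ k, List (Γ k)) → ℕ → (∀ k, List (Γ k)) → Prop
  | skip {s n} : 1 ≤ n → Exec skip s n s
  | push {k x s n} : 1 ≤ n → Exec (push k x) s n (update s k (x :: s k))
  | seq {p q s s' s'' t t' n} : Exec p s t s' → Exec q s' t' s'' → t + t' ≤ n →
      Exec (seq p q) s n s''
  | case {k p s s' t n} : Exec (p (s k).head?) (update s k (s k).tail) t s' → t + 1 ≤ n →
      Exec (case k p) s n s'
  | loop_nil {k p s n} : s k = [] → 1 ≤ n → Exec (loop k p) s n s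
  | loop_cons {k p s s' s'' x l t t' n} : s k = x :: l → Exec (p x) (update s k l) t s' →
      Exec (loop k p) s' t' s'' → t + t' + 1 ≤ n → Exec (loop k p) s n s''

theorem Exec.mono {p : StackProg Γ} {s s' : ∀ k, List (Γ k)} {n m : ℕ} (h : Exec p s n s')
    (hnm : n ≤ m) : Exec p s m s' := by
  cases h with
  | skip h => exact .skip (h.trans hnm)
  | push h => exact .push (h.trans hnm)
  | seq h₁ h₂ h => exact .seq h₁ h₂ (h.trans hnm)
  | case h₁ h => exact .case h₁ (h.trans hnm)
  | loop_nil h₁ h => exact .loop_nil h₁ (h.trans hnm)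
  | loop_cons h₁ h₂ h₃ h => exact .loop_cons h₁ h₂ h₃ (h.trans hnm)

/-- The labels of the machine that runs a program. -/
@[reducible] def Label : StackProg Γ → Type
  | skip => Unit
  | push _ _ => Unit
  | seq p q => p.Label ⊕ q.Label
  | case _ p => Option (Σ x, (p x).Label)
  | loop _ p => Option (Σ x, (p x).Label)

omit [DecidableEq K] in
theorem Label.finite [∀ k, Finite (Γ k)] : ∀ p : StackProg Γ, Finite p.Label
  | skip => inferInstanceAs (Finite Unit)
  | push _ _ => inferInstanceAs (Finite Unit)
  | seq p q =>
    have := finite p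
    have := finite q
    inferInstanceAs (Finite (p.Label ⊕ q.Label))
  | case _ p =>
    have := fun x => finite (p x)
    inferInstanceAs (Finite (Option (Σ x, (p x).Label)))
  | loop _ p =>
    have := fun x => finite (p x)
    inferInstanceAs (Finite (Option (Σ x, (p x).Label)))

/-- The label at which a program starts. -/
def entry : ∀ p : StackProg Γ, p.Label
  | skip => ()
  | push _ _ => ()
  | seq p _ => Sum.inl p.entry
  | case _ _ => none
  | loop _ _ => none

/-- The statements at the labels of a program, where `e` embeds the labels into those of the whole
machine, and `nxt` is the label to go to when the program stops. The internal state keeps the symbol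
last popped from each stack. -/
def compile {Λ : Type} : ∀ (p : StackProg Γ) (_ : p.Label → Λ) (_ : Λ),
    p.Label → TM2.Stmt Γ Λ (∀ k, Option (Γ k))
  | skip, _, nxt, _ => .goto fun _ => nxt
  | push k x, _, nxt, _ => .push k (fun _ => x) (.goto fun _ => nxt)
  | seq p q, e, _, Sum.inl l => compile p (fun l => e (Sum.inl l)) (e (Sum.inr q.entry)) l
  | seq _ q, e, nxt, Sum.inr l => compile q (fun l => e (Sum.inr l)) nxt l
  | case k p, e, _, none =>
    .pop k (fun v x => update v k x) (.goto fun v => e (some ⟨v k, (p (v k)).entry⟩))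
  | case _ p, e, nxt, some ⟨x, l⟩ => compile (p x) (fun l => e (some ⟨x, l⟩)) nxt l
  | loop k p, e, nxt, none =>
    .pop k (fun v x => update v k x) (.goto fun v =>
      (v k).elim nxt fun x => e (some ⟨x, (p x).entry⟩))
  | loop _ p, e, _, some ⟨x, l⟩ => compile (p x) (fun l => e (some ⟨x, l⟩)) (e none) l

theorem iterate_bind_add {α : Type} {f : α → Option α} {a b : α} {c : Option α} {m n : ℕ}
    (h₁ : (flip bind f)^[m] (some a) = some b) (h₂ : (flip bind f)^[n] (some b) = c) :
    (flip bind f)^[n + m] (some a) = c := by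
  rw [iterate_add_apply, h₁, h₂]

/-- Induction on the execution. The embedding of labels and the exit label are arbitrary so that the
induction hypothesis applies to a subprogram inside a larger machine. The internal state can be
arbitrary because a popped symbol is always stored before it is inspected. -/
theorem Exec.compile {p : StackProg Γ} {s s' : ∀ k, List (Γ k)} {n : ℕ} (h : Exec p s n s') :
    ∀ {Λ : Type} (e : p.Label → Λ) (nxt : Λ) (M : Λ → TM2.Stmt Γ Λ (∀ k, Option (Γ k))),
      (∀ l, M (e l) = compile p e nxt l) → ∀ v, ∃ v' t, t ≤ n ∧
        (flip bind (TM2.step M))^[t] (some ⟨some (e p.entry), v, s⟩) =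
          some ⟨some nxt, v', s'⟩ := by
  induction h with
  | skip h =>
    intro Λ e nxt M hM v
    refine ⟨v, 1, h, ?_⟩
    simp [flip, hM, StackProg.compile]
  | push h =>
    intro Λ e nxt M hM v
    refine ⟨v, 1, h, ?_⟩
    simp [flip, hM, StackProg.compile]
  | @seq p q s s' s'' t t' n _ _ h ih₁ ih₂ =>
    intro Λ e nxt M hM v
    obtain ⟨v₁, t₁, ht₁, h₁⟩ := ih₁ (fun l => e (Sum.inl l)) (e (Sum.inr q.entry)) M
      (fun _ => (hM _).trans rfl) v
    obtain ⟨v₂, t₂, ht₂, h₂⟩ := ih₂ (fun l => e (Sum.inr l)) nxt M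
      (fun _ => (hM _).trans rfl) v₁
    exact ⟨v₂, t₂ + t₁, by omega, iterate_bind_add h₁ h₂⟩
  | @case k p s s' t n _ h ih =>
    intro Λ e nxt M hM v
    obtain ⟨v₁, t₁, ht₁, h₁⟩ := ih (fun l => e (some ⟨_, l⟩)) nxt M
      (fun _ => (hM _).trans rfl) (update v k (s k).head?)
    refine ⟨v₁, t₁ + 1, by omega, iterate_bind_add ?_ h₁⟩
    have h₀ := hM none
    simp only [iterate_one, flip, Option.bind_eq_bind, Option.bind_some, entry, TM2.step,
      h₀, StackProg.compile, TM2.stepAux]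
    rw [update_self]
  | @loop_nil k p s n hs h =>
    intro Λ e nxt M hM v
    refine ⟨update v k none, 1, h, ?_⟩
    have : update s k [] = s := by rw [← hs, update_eq_self]
    have h₀ := hM none
    simp [flip, h₀, StackProg.compile, entry, hs, this]
  | @loop_cons k p s s' s'' x l t t' n hs _ _ h ih₁ ih₂ =>
    intro Λ e nxt M hM v
    obtain ⟨v₁, t₁, ht₁, h₁⟩ := ih₁ (fun l => e (some ⟨_, l⟩)) (e none) M
      (fun _ => (hM _).trans rfl) (update v k (some x))
    obtain ⟨v₂, t₂, ht₂, h₂⟩ := ih₂ e nxt M hM v₁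
    refine ⟨v₂, t₂ + (t₁ + 1), by omega, iterate_bind_add (iterate_bind_add ?_ h₁) h₂⟩
    have h₀ := hM none
    simp [flip, h₀, StackProg.compile, entry, hs]

-- This is the form in which `initList` and `haltList` describe the stacks.
omit [DecidableEq K] in
theorem dite_eq_update [DecidableEq K] (k₀ k : K) (l : List (Γ k₀)) :
    (if h : k = k₀ then by rw [h]; exact l else []) = update (fun k => ([] : List (Γ k))) k₀ l k := by
  by_cases hk : k = k₀
  · subst hk
    simp
  · simp [hk]

/-! ### From programs to polynomial-time machines -/

section Machine

variable [Fintype K] [∀ k, Fintype (Γ k)]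

/-- The machine that runs a program, with input stack `k₀` and output stack `k₁`. -/
noncomputable abbrev toFinTM2 (p : StackProg Γ) (k₀ k₁ : K) : FinTM2 where
  K := K
  k₀ := k₀
  k₁ := k₁
  Γ := Γ
  Λ := Option p.Label
  main := some p.entry
  ΛFin := by
    have := Label.finite p
    exact Fintype.ofFinite _
  σ := ∀ k, Option (Γ k)
  initialState := fun _ => none
  σFin := Fintype.ofFinite _
  m := fun l => l.elim (.load (fun _ _ => none) .halt) (p.compile some none)

/-- A program that, for all inputs, stops within polynomial time and leaves the right output on the
output stack, all other stacks being empty, proves that a function is computable in polynomial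
time. -/
theorem nonempty_computable {α β Γ₀ Γ₁ : Type} {ea : α → List Γ₀} {eb : β → List Γ₁} {f : α → β}
    (p : StackProg Γ) (k₀ k₁ : K) (e₀ : Γ k₀ ≃ Γ₀) (e₁ : Γ k₁ ≃ Γ₁) (q : Polynomial ℕ)
    (h : ∀ a, Exec p (update (fun _ => []) k₀ ((ea a).map e₀.symm)) (q.eval (ea a).length)
      (update (fun _ => []) k₁ ((eb (f a)).map e₁.symm))) :
    Nonempty (TM2ComputableInPolyTime ea eb f) := by
  -- The additional step is the exit label `none`, which clears the internal state and halts.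
  refine ⟨⟨⟨p.toFinTM2 k₀ k₁, e₀, e₁⟩, q + 1, fun a => ?_⟩⟩
  have key := (h a).compile (Λ := Option p.Label) some none (p.toFinTM2 k₀ k₁).m
    (fun l => rfl) (fun _ => none)
  choose v t ht h₁ using key
  refine ⟨⟨t.succ, ?_⟩, by simpa using ht⟩
  have e1 : initList (p.toFinTM2 k₀ k₁) ((ea a).map e₀.symm) =
      ⟨some (some p.entry), fun _ => none, update (fun _ => []) k₀ ((ea a).map e₀.symm)⟩ := by
    unfold initList
    congr 1
    funext k
    exact dite_eq_update _ _ _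
  have e2 : haltList (p.toFinTM2 k₀ k₁) ((eb (f a)).map e₁.symm) =
      ⟨none, fun _ => none, update (fun _ => []) k₁ ((eb (f a)).map e₁.symm)⟩ := by
    unfold haltList
    congr 1
    funext k
    exact dite_eq_update _ _ _
  have h₂ := iterate_bind_add (c := some (haltList (p.toFinTM2 k₀ k₁) ((eb (f a)).map e₁.symm)))
    (n := 1) h₁ (by
      rw [e2]
      rfl)
  change (flip bind (p.toFinTM2 k₀ k₁).step)^[t + 1] _ = _
  rw [Nat.add_comm]
  refine Eq.trans (congrArg _ (congrArg some e1)) h₂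

end Machine

end StackProg

/-! ### A stack of binary trees -/

/-- Binary trees, the data of our programs. -/
inductive BTree : Type
  | nil : BTree
  | cons (a b : BTree) : BTree

namespace BTree

/-- The length of the code of a tree. -/
@[simp] def size : BTree → ℕ
  | nil => 1
  | cons a b => a.size + b.size + 1

/-- Trees as strings. -/
@[simp] def code : BTree → List Bool
  | nil => [false]
  | cons a b => true :: (a.code ++ b.code)

@[simp] theorem length_code : ∀ t : BTree, t.code.length = t.size
  | nil => rfl
  | cons a b => by simp [length_code a, length_code b]

theorem one_le_size : ∀ t : BTree, 1 ≤ t.size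
  | nil => le_rfl
  | cons a b => by simp

end BTree

namespace TreeProg

/-- The stacks of our machine: one for the input, one for the data, and three auxiliary ones. -/
inductive Reg
  | inp | main | aux | tmp | cnt
  deriving DecidableEq

instance : Fintype Reg := ⟨{.inp, .main, .aux, .tmp, .cnt}, fun x => by cases x <;> decide⟩

/-- The alphabets of the stacks. -/
abbrev Alphabet : Reg → Type
  | .inp => RatAutomaton.Sym
  | .main => Bool
  | .aux => Bool
  | .tmp => Bool
  | .cnt => Bool

/-- Programs on these stacks. -/
abbrev Prog := StackProg Alphabet

open StackProg Reg

/-- The contents of all stacks. -/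
def regs (i : List RatAutomaton.Sym) (m a b c : List Bool) : ∀ k, List (Alphabet k)
  | .inp => i
  | .main => m
  | .aux => a
  | .tmp => b
  | .cnt => c

section
variable {i i' : List RatAutomaton.Sym} {m a b c l : List Bool}

@[simp] theorem update_inp : update (regs i m a b c) inp i' = regs i' m a b c := by
  funext k; cases k <;> rfl
@[simp] theorem update_main : update (regs i m a b c) main l = regs i l a b c := by
  funext k; cases k <;> rfl
@[simp] theorem update_aux : update (regs i m a b c) aux l = regs i m l b c := by
  funext k; cases k <;> rfl
@[simp] theorem update_tmp : update (regs i m a b c) tmp l = regs i m a l c := by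
  funext k; cases k <;> rfl
@[simp] theorem update_cnt : update (regs i m a b c) cnt l = regs i m a b l := by
  funext k; cases k <;> rfl

theorem exec_push_main (x : Bool) :
    Exec (push main x : Prog) (regs i m a b c) 1 (regs i (x :: m) a b c) := by
  have h := Exec.push (k := main) (x := x) (s := regs i m a b c) le_rfl
  rwa [update_main] at h
theorem exec_push_aux (x : Bool) :
    Exec (push aux x : Prog) (regs i m a b c) 1 (regs i m (x :: a) b c) := by
  have h := Exec.push (k := aux) (x := x) (s := regs i m a b c) le_rfl
  rwa [update_aux] at h
theorem exec_push_tmp (x : Bool) :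
    Exec (push tmp x : Prog) (regs i m a b c) 1 (regs i m a (x :: b) c) := by
  have h := Exec.push (k := tmp) (x := x) (s := regs i m a b c) le_rfl
  rwa [update_tmp] at h
theorem exec_push_cnt (x : Bool) :
    Exec (push cnt x : Prog) (regs i m a b c) 1 (regs i m a b (x :: c)) := by
  have h := Exec.push (k := cnt) (x := x) (s := regs i m a b c) le_rfl
  rwa [update_cnt] at h

theorem exec_case_main {x : Bool} {p : Option Bool → Prog} {n s}
    (h : Exec (p (some x)) (regs i m a b c) n s) :
    Exec (case main p : Prog) (regs i (x :: m) a b c) (n + 1) s :=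
  .case (k := main) (by simpa [regs] using h) le_rfl

theorem exec_loop_aux {x : Bool} {p : Bool → Prog} {n n' s s'}
    (h : Exec (p x) (regs i m a b c) n s) (h' : Exec (loop aux p) s n' s') :
    Exec (loop aux p : Prog) (regs i m (x :: a) b c) (n + n' + 1) s' :=
  .loop_cons (k := aux) rfl (by simpa using h) h' le_rfl
theorem exec_loop_tmp {x : Bool} {p : Bool → Prog} {n n' s s'}
    (h : Exec (p x) (regs i m a b c) n s) (h' : Exec (loop tmp p) s n' s') :
    Exec (loop tmp p : Prog) (regs i m a (x :: b) c) (n + n' + 1) s' :=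
  .loop_cons (k := tmp) rfl (by simpa using h) h' le_rfl
theorem exec_loop_cnt {x : Bool} {p : Bool → Prog} {n n' s s'}
    (h : Exec (p x) (regs i m a b c) n s) (h' : Exec (loop cnt p) s n' s') :
    Exec (loop cnt p : Prog) (regs i m a b (x :: c)) (n + n' + 1) s' :=
  .loop_cons (k := cnt) rfl (by simpa using h) h' le_rfl

/-- Move the auxiliary stack to the data stack. -/
def auxToMain : Prog := loop aux fun x => push main x

theorem exec_auxToMain : ∀ (a m : List Bool),
    Exec auxToMain (regs i m a b c) (2 * a.length + 1) (regs i (a.reverse ++ m) [] b c)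
  | [], m => .loop_nil rfl (by simp)
  | x :: a, m => by
    have h := exec_loop_aux (exec_push_main (i := i) (m := m) (a := a) (b := b) (c := c) x)
      (exec_auxToMain a (x :: m))
    simpa [auxToMain] using h.mono (by simp; omega)

/-- Move the second auxiliary stack to the data stack. -/
def tmpToMain : Prog := loop tmp fun x => push main x

theorem exec_tmpToMain : ∀ (b m : List Bool),
    Exec tmpToMain (regs i m a b c) (2 * b.length + 1) (regs i (b.reverse ++ m) a [] c)
  | [], m => .loop_nil rfl (by simp)
  | x :: b, m => by
    have h := exec_loop_tmp (exec_push_main (i := i) (m := m) (a := a) (b := b) (c := c) x)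
      (exec_tmpToMain b (x :: m))
    simpa [tmpToMain] using h.mono (by simp; omega)

/-- Move the second auxiliary stack to the first one. -/
def tmpToAux : Prog := loop tmp fun x => push aux x

theorem exec_tmpToAux : ∀ (b a : List Bool),
    Exec tmpToAux (regs i m a b c) (2 * b.length + 1) (regs i m (b.reverse ++ a) [] c)
  | [], a => .loop_nil rfl (by simp)
  | x :: b, a => by
    have h := exec_loop_tmp (exec_push_aux (i := i) (m := m) (a := a) (b := b) (c := c) x)
      (exec_tmpToAux b (x :: a))
    simpa [tmpToAux] using h.mono (by simp; omega)

/-- Move the auxiliary stack to both the data stack and the second auxiliary stack. -/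
def auxToBoth : Prog := loop aux fun x => seq (push main x) (push tmp x)

theorem exec_auxToBoth : ∀ (a m b : List Bool),
    Exec auxToBoth (regs i m a b c) (3 * a.length + 1)
      (regs i (a.reverse ++ m) [] (a.reverse ++ b) c)
  | [], m, b => .loop_nil rfl (by simp)
  | x :: a, m, b => by
    have h := exec_loop_aux (.seq (exec_push_main (i := i) (m := m) (a := a) (b := b) (c := c) x)
      (exec_push_tmp x) le_rfl) (exec_auxToBoth a (x :: m) (x :: b))
    simpa [auxToBoth] using h.mono (by simp; omega)

/-- Pop a tree from the data stack, and do something with each symbol of its code. -/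
def popTree (act : Bool → Prog) : Prog :=
  seq (push cnt true) (loop cnt fun _ => case main fun x =>
    if x = some true then seq (act true) (seq (push cnt true) (push cnt true)) else act false)

/-- The prefix code is self-delimiting: `cnt` holds in unary the number of trees still to be read, a
leaf lowers it by one, and a node replaces one tree by two. The claim is in continuation form so
that the two subtrees of a node can be treated in turn. -/
theorem exec_popTree_loop {act : Bool → Prog} {fa fb : List Bool → Bool → List Bool}
    (hact : ∀ x m a b c, Exec (act x) (regs i m a b c) 1 (regs i m (fa a x) (fb b x) c)) :
    ∀ (t : BTree) {m a b c n s},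
    Exec (loop cnt fun _ => case main fun x =>
      if x = some true then seq (act true) (seq (push cnt true) (push cnt true)) else act false : Prog)
      (regs i m (t.code.foldl fa a) (t.code.foldl fb b) c) n s →
    Exec (loop cnt fun _ => case main fun x =>
      if x = some true then seq (act true) (seq (push cnt true) (push cnt true)) else act false : Prog)
      (regs i (t.code ++ m) a b (true :: c)) (5 * t.size + n) s
  | .nil, m, a, b, c, n, s, h =>
    (exec_loop_cnt (exec_case_main (x := false) (by simpa using hact _ _ _ _ _)) h).mono
      (by simp only [BTree.size]; omega)
  | .cons t u, m, a, b, c, n, s, h => by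
    have h₁ : Exec (seq (act true) (seq (push cnt true) (push cnt true)) : Prog)
        (regs i (t.code ++ (u.code ++ m)) a b c) 3
        (regs i (t.code ++ (u.code ++ m)) (fa a true) (fb b true) (true :: true :: c)) :=
      .seq (hact true _ a b c) (.seq (exec_push_cnt true) (exec_push_cnt true) le_rfl) (le_refl 3)
    have h₂ := exec_popTree_loop hact t (m := u.code ++ m) (a := fa a true) (b := fb b true)
      (exec_popTree_loop hact u (by simpa using h))
    have h₃ := exec_loop_cnt (x := true) (exec_case_main (x := true) (p := fun x => if x = some true then
      seq (act true) (seq (push cnt true) (push cnt true)) else act false) (by simpa using h₁)) h₂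
    simpa using h₃.mono (m := 5 * (BTree.cons t u).size + n) (by simp only [BTree.size]; omega)

theorem exec_popTree {act : Bool → Prog} {fa fb : List Bool → Bool → List Bool}
    (hact : ∀ x m a b c, Exec (act x) (regs i m a b c) 1 (regs i m (fa a x) (fb b x) c))
    (t : BTree) :
    Exec (popTree act) (regs i (t.code ++ m) a b []) (5 * t.size + 2)
      (regs i m (t.code.foldl fa a) (t.code.foldl fb b) []) :=
  .seq (exec_push_cnt true) (exec_popTree_loop hact t (.loop_nil rfl le_rfl)) (by omega)

end

theorem exec_popTree_aux {m a b} (t : BTree) :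
    Exec (popTree fun x => push aux x) (regs [] (t.code ++ m) a b []) (5 * t.size + 2)
      (regs [] m (t.code.reverse ++ a) b []) := by
  simpa using exec_popTree (fa := fun a x => x :: a) (fb := fun b _ => b)
    (fun x m a b c => exec_push_aux x) t

theorem exec_popTree_tmp {m a b} (t : BTree) :
    Exec (popTree fun x => push tmp x) (regs [] (t.code ++ m) a b []) (5 * t.size + 2)
      (regs [] m a (t.code.reverse ++ b) []) := by
  simpa using exec_popTree (fb := fun a x => x :: a) (fa := fun b _ => b)
    (fun x m a b c => exec_push_tmp x) t

/-- The data stack with the given trees on it. -/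
def config (xs : List BTree) : ∀ k, List (Alphabet k) := regs [] (xs.flatMap BTree.code) [] [] []

/-- The program transforms the trees on the data stack in the given way. -/
def Runs (P : Prog) (n : ℕ) (xs ys : List BTree) : Prop := Exec P (config xs) n (config ys)

theorem Runs.mono {P : Prog} {n m : ℕ} {xs ys : List BTree} (h : Runs P n xs ys) (hnm : n ≤ m) :
    Runs P m xs ys :=
  Exec.mono h hnm

theorem Runs.seq {P Q : Prog} {n m : ℕ} {xs ys zs : List BTree} (h : Runs P n xs ys)
    (h' : Runs Q m ys zs) : Runs (seq P Q) (n + m) xs zs :=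
  Exec.seq h h' le_rfl

/-! ### Elementary operations on a stack of trees -/

variable {x y z : BTree} {xs ys : List BTree}

theorem runs_skip : Runs skip 1 xs xs := .skip le_rfl

/-- Remove the tree on top. -/
def drop : Prog := popTree fun _ => skip

theorem runs_drop : Runs drop (5 * x.size + 2) (x :: xs) xs := by
  have := exec_popTree (i := []) (m := xs.flatMap BTree.code) (a := []) (b := [])
    (fa := fun a _ => a) (fb := fun b _ => b) (act := fun _ => skip)
    (fun x m a b c => .skip le_rfl) x
  simpa [Runs, config, drop] using this

/-- Duplicate the tree on top. -/
def dup : Prog := seq (popTree fun x => push aux x) (seq auxToBoth (seq tmpToAux auxToMain))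

/-- Every move between stacks reverses a code. The two copies reach the data stack after two and
four moves, so both are in the right order. -/
theorem runs_dup : Runs dup (20 * x.size) (x :: xs) (x :: x :: xs) := by
  have h := Exec.seq (exec_popTree_aux (m := xs.flatMap BTree.code) (a := []) (b := []) x)
    (.seq (exec_auxToBoth _ _ _) (.seq (exec_tmpToAux _ _) (exec_auxToMain _ _) le_rfl) le_rfl)
    le_rfl
  have := x.one_le_size
  simp only [List.length_append, List.length_reverse, List.length_nil, BTree.length_code] at h

  simpa [Runs, config, dup] using h.mono (m := 20 * x.size) (by omega)

/-- Swap the two trees on top. -/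
def swap : Prog :=
  seq (popTree fun x => push aux x) (seq (popTree fun x => push tmp x) (seq auxToMain tmpToMain))

theorem runs_swap : Runs swap (10 * (x.size + y.size)) (x :: y :: xs) (y :: x :: xs) := by
  have h := Exec.seq (exec_popTree_aux (m := y.code ++ xs.flatMap BTree.code) (a := []) (b := []) x)
    (.seq (exec_popTree_tmp y) (.seq (exec_auxToMain _ _) (exec_tmpToMain _ _) le_rfl) le_rfl)
    le_rfl
  have := x.one_le_size
  have := y.one_le_size
  simp only [List.length_append, List.length_reverse, List.length_nil, BTree.length_code] at h
  simpa [Runs, config, swap] using h.mono (m := 10 * (x.size + y.size)) (by omega)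

theorem runs_cons : Runs (push main true) 1 (x :: y :: xs) (.cons x y :: xs) := by
  simpa [Runs, config] using exec_push_main (i := []) (m := x.code ++ (y.code ++ xs.flatMap BTree.code))
    (a := []) (b := []) (c := []) true

/-- Make a tree of the second and the third tree on the stack. -/
def consUnder : Prog := seq (popTree fun x => push aux x) (seq (push main true) auxToMain)

theorem runs_consUnder :
    Runs consUnder (15 * x.size) (x :: y :: z :: xs) (x :: .cons y z :: xs) := by
  have h := Exec.seq (exec_popTree_aux
    (m := y.code ++ (z.code ++ xs.flatMap BTree.code)) (a := []) (b := []) x)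
    (.seq (exec_push_main true) (exec_auxToMain _ _) le_rfl) le_rfl
  have := x.one_le_size
  simp only [List.length_append, List.length_reverse, List.length_nil, BTree.length_code] at h
  simpa [Runs, config, consUnder] using h.mono (m := 15 * x.size) (by omega)

theorem runs_case_nil {p : Option Bool → Prog} {n} (h : Runs (p (some false)) n xs ys) :
    Runs (case main p) (n + 1) (.nil :: xs) ys := by
  simpa [Runs, config] using exec_case_main (m := xs.flatMap BTree.code) h

theorem runs_case_cons {p : Option Bool → Prog} {n} (h : Runs (p (some true)) n (x :: y :: xs) ys) :
    Runs (case main p) (n + 1) (.cons x y :: xs) ys := by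
  simpa [Runs, config] using exec_case_main
    (m := x.code ++ (y.code ++ xs.flatMap BTree.code)) (by simpa [Runs, config] using h)

/-- Push a fixed tree. -/
def pushTree : BTree → Prog
  | .nil => push main false
  | .cons a b => seq (pushTree b) (seq (pushTree a) (push main true))

theorem exec_pushTree {i : List RatAutomaton.Sym} : ∀ (t : BTree) (m : List Bool),
    Exec (pushTree t) (regs i m [] [] []) t.size (regs i (t.code ++ m) [] [] [])
  | .nil, m => exec_push_main false
  | .cons a b, m => by
    have h := Exec.seq (exec_pushTree (i := i) b m) (.seq (exec_pushTree a _) (exec_push_main true) le_rfl)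
      le_rfl
    simpa [pushTree] using h.mono (m := a.size + b.size + 1) (by omega)

theorem runs_pushTree (t : BTree) (xs : List BTree) : Runs (pushTree t) t.size xs (t :: xs) :=
  exec_pushTree t _

/-- Repeat a program as long as the tree on top has children, which it gets separately. -/
def whileCons (P : Prog) : Prog :=
  seq (push cnt true) (loop cnt fun _ => case main fun x =>
    if x = some true then seq P (push cnt true) else skip)

theorem runs_whileCons_nil {P : Prog} : Runs (whileCons P) 5 (.nil :: xs) xs := by
  have h₁ := exec_case_main (i := []) (m := xs.flatMap BTree.code) (a := []) (b := []) (c := [])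
    (x := false) (p := fun x => if x = some true then P.seq (push cnt true) else skip) (n := 1)
    (by simpa using .skip le_rfl)
  have h₂ := Exec.seq (exec_push_cnt true)
    (exec_loop_cnt h₁ (.loop_nil (p := fun _ => case main fun x => if x = some true then
      P.seq (push cnt true) else skip) rfl le_rfl)) le_rfl
  simpa [Runs, config, whileCons] using h₂.mono (m := 5) (by omega)

/-- A mark on `cnt` is the loop condition, renewed after a node and not after a leaf. It is popped
before `P` starts, so `P` may use `cnt` itself. A run of the whole program from `ys` begins by
pushing the mark; what follows that push is precisely the continuation of the loop. -/
theorem runs_whileCons_cons {P : Prog} {n n' : ℕ} {zs : List BTree}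
    (h : Runs P n (x :: y :: xs) ys) (h' : Runs (whileCons P) n' ys zs) :
    Runs (whileCons P) (n + n' + 4) (.cons x y :: xs) zs := by
  cases h' with
  | @seq _ _ _ s _ t t' _ h₁ h₂ hle =>
    have hs : s = regs [] (ys.flatMap BTree.code) [] [] [true] := by
      cases h₁ with
      | push _ => simp [config, regs]
    subst hs
    have h₃ : Exec (seq P (push cnt true)) (config (x :: y :: xs)) (n + 1)
        (regs [] (ys.flatMap BTree.code) [] [] [true]) :=
      .seq h (exec_push_cnt true) le_rfl
    have h₄ := exec_case_main (i := []) (m := x.code ++ (y.code ++ xs.flatMap BTree.code))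
      (a := []) (b := []) (c := []) (x := true) (p := fun x => if x = some true then
      P.seq (push cnt true) else skip) (by simpa [config] using h₃)
    have h₅ := Exec.seq (exec_push_cnt true) (exec_loop_cnt h₄ h₂) le_rfl
    simpa [Runs, config, whileCons] using h₅.mono (m := n + n' + 4) (by omega)

end TreeProg

/-! ### Functions computable in polynomial time -/

/-- Types whose elements are represented by trees. -/
class TreeEncodable (α : Type) where
  /-- the tree that represents an element -/
  enc : α → BTree

namespace TreeProg

open StackProg Reg TreeEncodable

variable {α β γ σ : Type} [TreeEncodable α] [TreeEncodable β] [TreeEncodable γ] [TreeEncodable σ]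

/-- The size of the representation of an element. -/
def size (a : α) : ℕ := (enc a).size

/-- Both values have size 5, so sizes of bit strings depend only on their lengths. The second symbol
of the code tells the values apart. -/
instance : TreeEncodable Bool :=
  ⟨fun b => bif b then .cons (.cons .nil .nil) .nil else .cons .nil (.cons .nil .nil)⟩
instance : TreeEncodable (α × β) := ⟨fun p => .cons (enc p.1) (enc p.2)⟩

/-- The tree of a list: a right comb. -/
def encList : List α → BTree
  | [] => .nil
  | x :: l => .cons (enc x) (encList l)

instance : TreeEncodable (List α) := ⟨encList⟩

theorem one_le_size (a : α) : 1 ≤ size a := (enc a).one_le_size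
@[simp] theorem size_pair (a : α) (b : β) : size (a, b) = size a + size b + 1 := rfl
@[simp] theorem size_nil : size ([] : List α) = 1 := rfl
@[simp] theorem size_cons (a : α) (l : List α) : size (a :: l) = size a + size l + 1 := rfl
@[simp] theorem size_bool (b : Bool) : size b = 5 := by cases b <;> rfl

theorem size_append (l m : List α) : size (l ++ m) + 1 = size l + size m := by
  induction l with
  | nil => simp; omega
  | cons a l ih => simp; omega

theorem length_lt_size (l : List α) : l.length < size l := by
  induction l with
  | nil => simp
  | cons a l ih => simp; omega

theorem size_le_of_mem {a : α} {l : List α} (h : a ∈ l) : size a ≤ size l := by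
  induction l with
  | nil => simp at h
  | cons b l ih =>
    simp only [List.mem_cons] at h
    rcases h with rfl | h
    · simp; omega
    · have := ih h
      simp; omega

theorem size_le_of_forall {l : List α} {n : ℕ} (h : ∀ a ∈ l, size a ≤ n) :
    size l ≤ l.length * (n + 1) + 1 := by
  induction l with
  | nil => simp
  | cons a l ih =>
    have h₁ := ih fun b hb => h b (by simp [hb])
    have h₂ := h a (by simp)
    simp only [size_cons, List.length_cons, add_mul, one_mul]
    omega

theorem eval_mono (p : Polynomial ℕ) {m n : ℕ} (h : m ≤ n) : p.eval m ≤ p.eval n := by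
  rw [Polynomial.eval_eq_sum, Polynomial.eval_eq_sum]
  exact Finset.sum_le_sum fun i _ => Nat.mul_le_mul_left _ (Nat.pow_le_pow_left h i)

/-- A function to the natural numbers that is bounded by a polynomial in the size of the argument. -/
def PolyBdd (g : α → ℕ) : Prop := ∃ p : Polynomial ℕ, ∀ a, g a ≤ p.eval (size a)

namespace PolyBdd

theorem mono {f g : α → ℕ} (hf : PolyBdd f) (h : ∀ a, g a ≤ f a) : PolyBdd g :=
  let ⟨p, hp⟩ := hf
  ⟨p, fun a => (h a).trans (hp a)⟩

theorem const (n : ℕ) : PolyBdd fun _ : α => n := ⟨.C n, fun _ => by simp⟩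

theorem id : PolyBdd fun a : α => size a := ⟨.X, fun _ => by simp⟩

theorem add {f g : α → ℕ} (hf : PolyBdd f) (hg : PolyBdd g) : PolyBdd fun a => f a + g a :=
  let ⟨p, hp⟩ := hf
  let ⟨q, hq⟩ := hg
  ⟨p + q, fun a => by simpa using Nat.add_le_add (hp a) (hq a)⟩

theorem mul {f g : α → ℕ} (hf : PolyBdd f) (hg : PolyBdd g) : PolyBdd fun a => f a * g a :=
  let ⟨p, hp⟩ := hf
  let ⟨q, hq⟩ := hg
  ⟨p * q, fun a => by simpa using Nat.mul_le_mul (hp a) (hq a)⟩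

theorem eval {f : α → ℕ} (hf : PolyBdd f) (p : Polynomial ℕ) : PolyBdd fun a => p.eval (f a) :=
  let ⟨q, hq⟩ := hf
  ⟨p.comp q, fun a => by simpa using eval_mono p (hq a)⟩

theorem comp {g : β → ℕ} {f : α → β} (hg : PolyBdd g) (hf : PolyBdd fun a => size (f a)) :
    PolyBdd fun a => g (f a) :=
  let ⟨p, hp⟩ := hg
  (hf.eval p).mono fun _ => hp _

end PolyBdd

/-- A function is computable in polynomial time if there is a program that replaces the tree of `a`
on top of the stack by that of `f a`, within polynomial time. -/
@[fun_prop]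
def PolyTime (f : α → β) : Prop :=
  PolyBdd (fun a => size (f a)) ∧ ∃ (P : Prog) (t : α → ℕ), PolyBdd t ∧
    ∀ a xs, Runs P (t a) (enc a :: xs) (enc (f a) :: xs)

/-! ### Closure properties of polynomial time -/

namespace PolyTime

theorem size {f : α → β} (hf : PolyTime f) : PolyBdd fun a => size (f a) := hf.1

/-- A function that does not change the representation. -/
theorem of_enc_eq {f : α → β} (h : ∀ a, enc (f a) = enc a) : PolyTime f :=
  ⟨PolyBdd.id.mono fun a => by simp [TreeProg.size, h],
    skip, fun _ => 1, .const 1, fun a xs => by rw [h]; exact runs_skip⟩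

@[fun_prop]
theorem id : PolyTime (fun a : α => a) := of_enc_eq fun _ => rfl

-- The second program runs in time polynomial in the size of `f a`; this is why `PolyTime` includes
-- a bound on the output size.
@[fun_prop]
theorem comp {g : β → γ} {f : α → β} (hg : PolyTime g) (hf : PolyTime f) :
    PolyTime fun a => g (f a) := by
  obtain ⟨hg, Q, u, hu, hQ⟩ := hg
  obtain ⟨hf, P, t, ht, hP⟩ := hf
  exact ⟨hg.comp hf, P.seq Q, _, ht.add (hu.comp hf), fun a xs => (hP a xs).seq (hQ _ xs)⟩

@[fun_prop]
theorem const (b : β) : PolyTime (fun _ : α => b) :=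
  ⟨.const _, drop.seq (pushTree (enc b)), _,
    ((PolyBdd.const 5).mul .id |>.add (.const 2)).add (.const (TreeProg.size b)),
    fun _ _ => runs_drop.seq (runs_pushTree _ _)⟩

@[fun_prop]
theorem prodMk {f : α → β} {g : α → γ} (hf : PolyTime f) (hg : PolyTime g) :
    PolyTime fun a => (f a, g a) := by
  obtain ⟨hg, Q, u, hu, hQ⟩ := hg
  obtain ⟨hf, P, t, ht, hP⟩ := hf
  exact ⟨(hf.add hg).add (.const 1), dup.seq (Q.seq (swap.seq (P.seq (push main true)))), _,
    ((PolyBdd.const 20).mul .id).add (hu.add (((PolyBdd.const 10).mul (hg.add .id)).add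
      (ht.add (.const 1)))),
    fun a xs => runs_dup.seq ((hQ a _).seq (runs_swap.seq ((hP a _).seq runs_cons)))⟩

theorem fst' : PolyTime (Prod.fst : α × β → α) :=
  ⟨PolyBdd.id.mono fun a => by rcases a with ⟨a, b⟩; simp; omega,
    case main fun _ => swap.seq drop, fun a => 15 * TreeProg.size a + 3,
    ((PolyBdd.const 15).mul .id).add (.const 3),
    fun a xs => (runs_case_cons (runs_swap.seq runs_drop)).mono (by
      rcases a with ⟨a, b⟩
      simp only [size_pair]
      simp only [TreeProg.size]
      omega)⟩

theorem snd' : PolyTime (Prod.snd : α × β → β) :=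
  ⟨PolyBdd.id.mono fun a => by rcases a with ⟨a, b⟩; simp; omega,
    case main fun _ => drop, fun a => 15 * TreeProg.size a + 3,
    ((PolyBdd.const 15).mul .id).add (.const 3),
    fun a xs => (runs_case_cons runs_drop).mono (by
      rcases a with ⟨a, b⟩
      simp only [size_pair]
      simp only [TreeProg.size]
      omega)⟩

@[fun_prop]
theorem fst {f : α → β × γ} (hf : PolyTime f) : PolyTime fun a => (f a).1 := fst'.comp hf

@[fun_prop]
theorem snd {f : α → β × γ} (hf : PolyTime f) : PolyTime fun a => (f a).2 := snd'.comp hf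

@[fun_prop]
theorem cond {c : α → Bool} {f g : α → β} (hc : PolyTime c) (hf : PolyTime f) (hg : PolyTime g) :
    PolyTime fun a => bif c a then f a else g a := by
  obtain ⟨hc, R, v, hv, hR⟩ := hc
  obtain ⟨hg, Q, u, hu, hQ⟩ := hg
  obtain ⟨hf, P, t, ht, hP⟩ := hf
  refine ⟨(hf.add hg).mono fun a => ?_,
    -- The two pops consume the first two symbols of the truth value. What remains is three leaves
    -- for `true`, removed in 21 steps, and one tree of size 3 for `false`, removed in 17.
    dup.seq (R.seq (case main fun _ => case main fun x => x.elim skip fun b =>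
      bif b then drop.seq (drop.seq (drop.seq P)) else drop.seq Q)), _,
    ((PolyBdd.const 20).mul .id).add (hv.add (((ht.add (.const 21)).add (hu.add (.const 17))).add
      (.const 2))),
    fun a xs => runs_dup.seq ((hR a _).seq ?_)⟩
  · dsimp only
    cases c a
    · exact Nat.le_add_left _ _
    · exact Nat.le_add_right _ _
  · dsimp only
    cases c a
    · have h := Runs.mono (m := u a + 17) ((runs_drop (x := .cons .nil .nil)).seq (hQ a xs))
        (by simp; omega)
      exact Runs.mono (runs_case_cons (runs_case_nil h)) (by omega)
    · have h := Runs.mono (m := t a + 21) ((runs_drop (x := .nil)).seq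
        ((runs_drop (x := .nil)).seq ((runs_drop (x := .nil)).seq (hP a xs)))) (by simp; omega)
      exact Runs.mono (runs_case_cons (runs_case_cons h)) (by omega)

/-- Case distinction on a list. -/
theorem list_cases {l : α → List β} {f : α → γ} {g : α → β → List β → γ} (hl : PolyTime l)
    (hf : PolyTime f) (hg : PolyTime fun p : α × β × List β => g p.1 p.2.1 p.2.2) :
    PolyTime fun a => List.casesOn (motive := fun _ => γ) (l a) (f a) (g a) := by
  obtain ⟨hl, R, v, hv, hR⟩ := hl
  obtain ⟨hg, Q, u, hu, hQ⟩ := hg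
  obtain ⟨hf, P, t, ht, hP⟩ := hf
  obtain ⟨pg, hpg⟩ := hg
  obtain ⟨pu, hpu⟩ := hu
  have hb := (PolyBdd.id (α := α)).add (hl.add (.const 1))
  have key : ∀ a b m, l a = b :: m → TreeProg.size (a, b, m) ≤
      TreeProg.size a + (TreeProg.size (l a) + 1) := by
    intro a b m h
    rw [h]
    simp only [size_pair, size_cons]
    omega
  refine ⟨(hf.add (hb.eval pg)).mono fun a => ?_,
    dup.seq (R.seq (case main fun x => x.elim P fun b => bif b then
      (push main true).seq (swap.seq ((push main true).seq Q)) else P)), _,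
    ((PolyBdd.const 20).mul .id).add (hv.add (((((PolyBdd.const 10).mul hb).add (.const 3)).add
      ((hb.eval pu).add ht)).add (.const 1))),
    fun a xs => runs_dup.seq ((hR a _).seq ?_)⟩
  · have key := key a
    dsimp only
    cases hla : l a with
    | nil => exact Nat.le_add_right _ _
    | cons b m =>
      have := (hpg (a, b, m)).trans (eval_mono pg (key b m hla))
      rw [hla] at this
      exact this.trans (Nat.le_add_left _ _)
  · have key := key a
    dsimp only
    cases hla : l a with
    | nil => exact Runs.mono (runs_case_nil (hP a xs)) (by omega)
    | cons b m =>
      have h₁ := (hpu (a, b, m)).trans (eval_mono pu (key b m hla))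
      have h₂ := key b m hla
      have h := runs_cons.seq (runs_swap.seq (runs_cons.seq (hQ (a, b, m) xs)))
      refine Runs.mono (runs_case_cons h) ?_
      rw [hla] at h₁
      have h₃ := size_cons b m
      simp only [TreeProg.size, BTree.size] at *
      omega

/-- The time bound for the body is required only at states that actually occur, those reached after
a prefix of the list. Size bounds will be known only for these. -/
theorem runs_whileCons_foldl {P : Prog} {f : σ → β → σ} {n : ℕ} {xs : List BTree} :
    ∀ (l : List β) (s : σ),
      (∀ l₁ h l₂, l = l₁ ++ h :: l₂ → Runs P n (enc h :: enc l₂ :: enc (l₁.foldl f s) :: xs)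
        (enc l₂ :: enc (f (l₁.foldl f s) h) :: xs)) →
      Runs (whileCons P) ((n + 4) * l.length + 5) (enc l :: enc s :: xs) (enc (l.foldl f s) :: xs)
  | [], s, _ => runs_whileCons_nil.mono (by simp)
  | h :: l, s, hP => by
    refine (runs_whileCons_cons (hP [] h l rfl) (runs_whileCons_foldl (n := n) l (f s h) ?_)).mono ?_
    · intro l₁ h' l₂ hl
      exact hP (h :: l₁) h' l₂ (by rw [hl]; rfl)
    · simp only [List.length_cons, mul_add, mul_one]
      omega

/-- Iteration along a list, if all intermediate results are of polynomial size. -/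
theorem foldl {l : α → List β} {s : α → σ} {f : α → σ → β → σ} (hl : PolyTime l) (hs : PolyTime s)
    (hf : PolyTime fun p : α × σ × β => f p.1 p.2.1 p.2.2) {B : α → ℕ} (hB : PolyBdd B)
    (h : ∀ a l₁ l₂, l a = l₁ ++ l₂ → TreeProg.size (l₁.foldl (f a) (s a)) ≤ B a) :
    PolyTime fun a => (l a).foldl (f a) (s a) := by
  -- The parameter `a` travels with the state, since the body of the loop has no other access to it.
  have hstep : PolyTime fun p : β × α × σ => (p.2.1, f p.2.1 p.2.2 p.1) :=
    prodMk (by fun_prop) (hf.comp (f := fun p : β × α × σ => (p.2.1, p.2.2, p.1)) (by fun_prop))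
  have hinit : PolyTime fun a => (l a, a, s a) := by fun_prop
  obtain ⟨-, P, t, ⟨pt, ht⟩, hP⟩ := hstep
  have hfold : ∀ a (m : List β) (s : σ), m.foldl (fun (p : α × σ) b => (p.1, f p.1 p.2 b)) (a, s) =
      (a, m.foldl (f a) s) := by
    intro a m
    induction m with
    | nil => intro s; rfl
    | cons b m ih => intro s; simp [ih]
  have hS : PolyBdd fun a => TreeProg.size (l a) + (TreeProg.size a + B a) + 2 :=
    ((hl.size).add (PolyBdd.id.add hB)).add (.const 2)
  have hloop : PolyTime fun a => (a, (l a).foldl (f a) (s a)) := by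
    obtain ⟨-, Q, u, hu, hQ⟩ := hinit
    refine ⟨(PolyBdd.id.add hB).add (.const 1) |>.mono fun a => ?_,
      Q.seq (case main fun _ => whileCons
        -- The stack goes from b, l₂, (a, s) through l₂, b, (a, s) and l₂, (b, a, s) to (b, a, s),
        -- l₂; then `P` updates the state and the last swap puts the rest of the list on top again.
        (swap.seq (consUnder.seq (swap.seq (P.seq swap))))), _,
      hu.add (((((((PolyBdd.const 45).mul hS).add (hS.eval pt)).add
        ((PolyBdd.const 10).mul hS)).add (.const 4)).mul hl.size).add (.const 6)),
      fun a xs => (hQ a xs).seq ?_⟩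
    · have := h a (l a) [] (by simp)
      simp only [size_pair]
      omega
    · have h₁ := runs_whileCons_foldl (P := swap.seq (consUnder.seq (swap.seq (P.seq swap))))
        (f := fun (p : α × σ) b => (p.1, f p.1 p.2 b)) (xs := xs)
        (n := 45 * (TreeProg.size (l a) + (TreeProg.size a + B a) + 2) +
          pt.eval (TreeProg.size (l a) + (TreeProg.size a + B a) + 2) +
          10 * (TreeProg.size (l a) + (TreeProg.size a + B a) + 2)) (l a) (a, s a) (by
        intro l₁ b l₂ hla
        rw [hfold]
        have e₁ := h a l₁ (b :: l₂) hla
        have e₂ := h a (l₁ ++ [b]) l₂ (by simp [hla])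
        have e₃ : TreeProg.size (b :: l₂) ≤ TreeProg.size (l a) := by
          have := size_append l₁ (b :: l₂)
          have := TreeProg.one_le_size l₁
          rw [hla]
          omega
        simp only [size_cons] at e₃
        rw [List.foldl_append] at e₂
        change TreeProg.size (f a (l₁.foldl (f a) (s a)) b) ≤ _ at e₂
        have e₄ := (ht (b, a, l₁.foldl (f a) (s a))).trans (eval_mono pt
          (n := TreeProg.size (l a) + (TreeProg.size a + B a) + 2) (by simp; omega))
        refine (runs_swap.seq (runs_consUnder.seq (runs_swap.seq
          ((hP (b, a, l₁.foldl (f a) (s a)) _).seq runs_swap)))).mono ?_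
        have e₅ : (enc (a, f a (l₁.foldl (f a) (s a)) b)).size ≤ TreeProg.size a + B a + 1 := by
          change TreeProg.size _ ≤ _
          simp only [size_pair]
          omega
        have e₆ : (enc (a, l₁.foldl (f a) (s a))).size ≤ TreeProg.size a + B a + 1 := by
          change TreeProg.size _ ≤ _
          simp only [size_pair]
          omega
        simp only [TreeProg.size, BTree.size] at *
        omega)
      rw [hfold] at h₁
      refine (runs_case_cons h₁).mono ?_
      have := Nat.mul_le_mul_left (45 * (TreeProg.size (l a) + (TreeProg.size a + B a) + 2) +
          pt.eval (TreeProg.size (l a) + (TreeProg.size a + B a) + 2) +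
          10 * (TreeProg.size (l a) + (TreeProg.size a + B a) + 2) + 4) (length_lt_size (l a)).le
      omega
  exact snd hloop

/-- Iteration along a list, if every step adds a bounded amount to the size. -/
theorem foldl_of_growth {l : α → List β} {s : α → σ} {f : α → σ → β → σ} (hl : PolyTime l)
    (hs : PolyTime s) (hf : PolyTime fun p : α × σ × β => f p.1 p.2.1 p.2.2) {B : α → ℕ}
    (hB : PolyBdd B)
    (h : ∀ a s, ∀ b ∈ l a, TreeProg.size (f a s b) ≤ TreeProg.size s + B a) :
    PolyTime fun a => (l a).foldl (f a) (s a) := by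
  refine foldl hl hs hf (hs.size.add (hl.size.mul hB)) fun a l₁ l₂ hla => ?_
  have key : ∀ (m : List β) (s : σ), (∀ b ∈ m, b ∈ l a) →
      TreeProg.size (m.foldl (f a) s) ≤ TreeProg.size s + m.length * B a := by
    intro m
    induction m with
    | nil => intro s _; simp
    | cons b m ih =>
      intro s hm
      have h₁ := ih (f a s b) fun b hb => hm b (by simp [hb])
      have h₂ := h a s b (hm b (by simp))
      simp only [List.foldl_cons, List.length_cons, add_mul, one_mul]
      omega
  refine (key l₁ (s a) fun b hb => by simp [hla, hb]).trans (Nat.add_le_add_left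
    (Nat.mul_le_mul_right _ ?_) _)
  have := length_lt_size (l a)
  rw [hla] at this ⊢
  simp only [List.length_append] at this
  omega

end PolyTime

end TreeProg

/-! ### Lists -/

namespace TreeProg

open StackProg Reg TreeEncodable

variable {α β γ σ : Type} [TreeEncodable α] [TreeEncodable β] [TreeEncodable γ] [TreeEncodable σ]

/-- The first elements of a list, as many as another list has. -/
def takeAs (n : List γ) (l : List β) : List β := (n.zip l).map Prod.snd

/-- A list without its first elements, as many as another list has. -/
def dropAs (n : List γ) (l : List β) : List β := n.foldl (fun l _ => l.tail) l

omit [TreeEncodable β] [TreeEncodable γ] in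
theorem takeAs_eq (n : List γ) (l : List β) : takeAs n l = l.take n.length := by
  induction n generalizing l with
  | nil => rfl
  | cons a n ih =>
    cases l with
    | nil => rfl
    | cons b l => simpa [takeAs] using ih l

omit [TreeEncodable β] [TreeEncodable γ] in
theorem dropAs_eq (n : List γ) (l : List β) : dropAs n l = l.drop n.length := by
  induction n generalizing l with
  | nil => rfl
  | cons a n ih =>
    cases l with
    | nil => simpa [dropAs] using ih []
    | cons b l => simpa [dropAs] using ih l

/-- One step of splitting a list into pieces of the same length. -/
def chunkStep (n : List γ) (s : List β × List (List β)) : List β × List (List β) :=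
  bif s.1.isEmpty then s else (dropAs n s.1, takeAs n s.1 :: s.2)

/-- Split a list into pieces, each as long as the list `n`. -/
def chunk (n : List γ) (l : List β) : List (List β) :=
  (l.foldl (fun s _ => chunkStep n s) (l, [])).2.reverse

/-! ### List functions in polynomial time -/

namespace PolyTime

@[fun_prop]
theorem list_cons {f : α → β} {l : α → List β} (hf : PolyTime f) (hl : PolyTime l) :
    PolyTime fun a => f a :: l a :=
  (of_enc_eq (f := fun p : β × List β => p.1 :: p.2) fun _ => rfl).comp (hf.prodMk hl)

@[fun_prop]
theorem list_tail {l : α → List β} (hl : PolyTime l) : PolyTime fun a => (l a).tail := by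
  have := list_cases (f := fun _ => []) (g := fun _ _ m => m) hl (by fun_prop) (by fun_prop)
  convert this using 2 with a
  cases l a <;> rfl

@[fun_prop]
theorem list_isEmpty {l : α → List β} (hl : PolyTime l) : PolyTime fun a => (l a).isEmpty := by
  have := list_cases (f := fun _ => true) (g := fun _ _ _ => false) hl (by fun_prop) (by fun_prop)
  convert this using 2 with a
  cases l a <;> rfl

@[fun_prop]
theorem list_headD {l : α → List β} (b : β) (hl : PolyTime l) :
    PolyTime fun a => (l a).headD b := by
  have := list_cases (f := fun _ => b) (g := fun _ b _ => b) hl (by fun_prop) (by fun_prop)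
  convert this using 2 with a
  cases l a <;> rfl

@[fun_prop]
theorem list_reverse {l : α → List β} (hl : PolyTime l) : PolyTime fun a => (l a).reverse := by
  have := foldl_of_growth (l := l) (s := fun _ => ([] : List β)) (f := fun _ s b => b :: s) hl
    (by fun_prop) (by fun_prop) (B := fun a => TreeProg.size (l a) + 1) (hl.size.add (.const 1))
    (fun a s b hb => by
      have := size_le_of_mem hb
      simp only [size_cons]
      omega)
  convert this using 2 with a
  simp

theorem list_map {l : α → List β} {f : α → β → γ} (hl : PolyTime l)
    (hf : PolyTime fun p : α × β => f p.1 p.2) : PolyTime fun a => (l a).map (f a) := by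
  obtain ⟨p, hp⟩ := hf.size
  have := foldl_of_growth (l := l) (s := fun _ => ([] : List γ)) (f := fun a s b => f a b :: s) hl
    (by fun_prop) (list_cons (hf.comp (f := fun p : α × List γ × β => (p.1, p.2.2)) (by fun_prop))
      (by fun_prop)) (((PolyBdd.id.add (hl.size.add (.const 1))).eval p).add (.const 1))
    (fun a s b hb => by
      have h₁ := (hp (a, b)).trans (eval_mono p
        (n := TreeProg.size a + (TreeProg.size (l a) + 1)) (by
          have := size_le_of_mem hb
          simp only [size_pair]
          omega))
      simp only [size_cons] at h₁ ⊢
      omega)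
  convert this.list_reverse using 2 with a
  have : ∀ (l : List β) m, l.foldl (fun s b => f a b :: s) m = (l.map (f a)).reverse ++ m := by
    intro l
    induction l with
    | nil => intro m; rfl
    | cons b l ih => intro m; simp [ih]
  simp [this]

@[fun_prop]
theorem list_append {l m : α → List β} (hl : PolyTime l) (hm : PolyTime m) :
    PolyTime fun a => l a ++ m a := by
  have := foldl_of_growth (l := fun a => (l a).reverse) (s := m) (f := fun _ s b => b :: s)
    hl.list_reverse hm (by fun_prop) (B := fun a => TreeProg.size (l a) + 1)
    (hl.size.add (.const 1)) (fun a s b hb => by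
      have := size_le_of_mem (List.mem_reverse.1 hb)
      simp only [size_cons]
      omega)
  convert this using 2 with a
  simp

@[fun_prop]
theorem list_flatten {l : α → List (List β)} (hl : PolyTime l) : PolyTime fun a => (l a).flatten := by
  have := foldl_of_growth (l := l) (s := fun _ => ([] : List β)) (f := fun _ s b => s ++ b) hl
    (by fun_prop) (by fun_prop) (B := fun a => TreeProg.size (l a)) hl.size
    (fun a s b hb => by
      have := size_le_of_mem hb
      have := size_append s b
      omega)
  convert this using 2 with a
  have : ∀ (l : List (List β)) m, l.foldl (fun s b => s ++ b) m = m ++ l.flatten := by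
    intro l
    induction l with
    | nil => intro m; simp
    | cons b l ih => intro m; simp [ih]
  simp [this]

theorem list_flatMap {l : α → List β} {f : α → β → List γ} (hl : PolyTime l)
    (hf : PolyTime fun p : α × β => f p.1 p.2) : PolyTime fun a => (l a).flatMap (f a) := by
  simpa only [List.flatMap_def] using (list_map hl hf).list_flatten

@[fun_prop]
theorem list_zip {l : α → List β} {m : α → List γ} (hl : PolyTime l) (hm : PolyTime m) :
    PolyTime fun a => (l a).zip (m a) := by
  have hstep : PolyTime fun p : α × (List γ × List (β × γ)) × β =>
      List.casesOn (motive := fun _ => List γ × List (β × γ)) p.2.1.1 p.2.1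
        fun c m => (m, (p.2.2, c) :: p.2.1.2) :=
    list_cases (by fun_prop) (by fun_prop) (by fun_prop)
  have := foldl_of_growth (l := l) (s := fun a => (m a, ([] : List (β × γ))))
    (f := fun _ s b => List.casesOn (motive := fun _ => List γ × List (β × γ)) s.1 s
        fun c m => (m, (b, c) :: s.2)) hl (by fun_prop) hstep
    (B := fun a => TreeProg.size (l a) + 2) (hl.size.add (.const 2))
    (fun a s b hb => by
      obtain ⟨m, s⟩ := s
      have := size_le_of_mem hb
      cases m with
      | nil => dsimp only; omega
      | cons c m => simp only [size_pair, size_cons]; omega)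
  convert this.snd.list_reverse using 2 with a
  have : ∀ (l : List β) (m : List γ) s, (l.foldl (fun s b =>
      List.casesOn (motive := fun _ => List γ × List (β × γ)) s.1 s
        fun c m => (m, (b, c) :: s.2)) (m, s)).2 = (l.zip m).reverse ++ s := by
    intro l
    induction l with
    | nil => intro m s; simp
    | cons b l ih =>
      intro m s
      cases m with
      | nil => simpa using ih [] s
      | cons c m => simpa using ih m ((b, c) :: s)
  simp [this]

theorem list_zipWith {l : α → List β} {m : α → List γ} {f : α → β → γ → σ} (hl : PolyTime l)
    (hm : PolyTime m) (hf : PolyTime fun p : α × β × γ => f p.1 p.2.1 p.2.2) :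
    PolyTime fun a => List.zipWith (f a) (l a) (m a) := by
  have := list_map (f := fun a (p : β × γ) => f a p.1 p.2) (hl.list_zip hm) hf
  convert this using 2 with a
  simp [List.zip, List.map_zipWith]

@[fun_prop]
theorem takeAs {n : α → List γ} {l : α → List β} (hn : PolyTime n) (hl : PolyTime l) :
    PolyTime fun a => takeAs (n a) (l a) := by
  unfold TreeProg.takeAs
  exact list_map (f := fun _ p => p.2) (hn.list_zip hl) (by fun_prop)

@[fun_prop]
theorem dropAs {n : α → List γ} {l : α → List β} (hn : PolyTime n) (hl : PolyTime l) :
    PolyTime fun a => dropAs (n a) (l a) := by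
  unfold TreeProg.dropAs
  exact foldl_of_growth (f := fun _ s _ => s.tail) hn hl (by fun_prop) (.const 0) fun a s _ _ => by
    cases s with
    | nil => simp
    | cons b s => simp; omega

@[fun_prop]
theorem chunk {n : α → List γ} {l : α → List β} (hn : PolyTime n) (hl : PolyTime l) :
    PolyTime fun a => chunk (n a) (l a) := by
  refine list_reverse (snd (foldl_of_growth (f := fun a s _ => chunkStep (n a) s)
    (s := fun a => (l a, ([] : List (List β)))) hl (by fun_prop) ?_ (.const 2) ?_))
  · have := hn.comp (f := fun p : α × (List β × List (List β)) × β => p.1) (by fun_prop)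
    unfold chunkStep
    fun_prop
  · rintro a ⟨s, m⟩ - -
    -- Cutting off a piece only moves entries from the rest to the pieces, so the total size grows
    -- by the constant 2.
    have h₁ := size_append (s.take (n a).length) (s.drop (n a).length)
    rw [List.take_append_drop] at h₁
    unfold chunkStep
    cases s.isEmpty
    · simp only [size_pair, size_cons, takeAs_eq, dropAs_eq, cond_false]
      omega
    · simp

end PolyTime

end TreeProg

/-! ### Arithmetic -/

namespace TreeProg

open StackProg Reg TreeEncodable

variable {α β γ σ : Type} [TreeEncodable α] [TreeEncodable β] [TreeEncodable γ] [TreeEncodable σ]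

instance : TreeEncodable ℕ := ⟨fun n => enc n.bits⟩
-- Storing positive and negative parts reduces integer arithmetic to natural numbers with truncated
-- subtraction.
instance : TreeEncodable ℤ := ⟨fun z => enc (z.toNat, (-z).toNat)⟩

theorem size_list_bool (l : List Bool) : size l = 6 * l.length + 1 := by
  induction l with
  | nil => rfl
  | cons b l ih => simp only [size_cons, size_bool, ih, List.length_cons]; omega

theorem size_nat (n : ℕ) : size n = 6 * n.size + 1 := by
  rw [← Nat.size_eq_bits_len, ← size_list_bool]
  rfl

theorem size_int (z : ℤ) : size z = size z.toNat + size (-z).toNat + 1 := rfl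

theorem Nat.size_add_le (m n : ℕ) : (m + n).size ≤ m.size + n.size + 1 := by
  rw [Nat.size_le]
  have h₁ := m.lt_size_self
  have h₂ := n.lt_size_self
  have h₃ : 2 ^ m.size ≤ 2 ^ (m.size + n.size) := Nat.pow_le_pow_right (by omega) (by omega)
  have h₄ : 2 ^ n.size ≤ 2 ^ (m.size + n.size) := Nat.pow_le_pow_right (by omega) (by omega)
  rw [pow_succ]
  omega

theorem Nat.size_mul_le (m n : ℕ) : (m * n).size ≤ m.size + n.size := by
  rw [Nat.size_le, pow_add]
  exact Nat.mul_lt_mul'' m.lt_size_self n.lt_size_self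

theorem size_nat_add_le (m n : ℕ) : size (m + n) ≤ size m + size n + 5 := by
  have := Nat.size_add_le m n
  simp only [size_nat]
  omega

theorem size_nat_mul_le (m n : ℕ) : size (m * n) ≤ size m + size n := by
  have := Nat.size_mul_le m n
  simp only [size_nat]
  omega

theorem size_nat_le_of_le {m n : ℕ} (h : m ≤ n) : size m ≤ size n := by
  have := Nat.size_le_size h
  simp only [size_nat]
  omega

theorem size_int_le {z : ℤ} {n : ℕ} (h : z.natAbs ≤ n) : size z ≤ 2 * size n + 1 := by
  have h₁ : size z.toNat ≤ size n := size_nat_le_of_le (by omega)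
  have h₂ : size (-z).toNat ≤ size n := size_nat_le_of_le (by omega)
  rw [size_int]
  omega

/-- The number with the given binary digits, most significant digit first. -/
def ofBits (l : List Bool) : ℕ := l.foldl (fun n b => Nat.bit b n) 0

theorem foldl_bit (l : List Bool) (n : ℕ) :
    l.foldl (fun n b => Nat.bit b n) n = n * 2 ^ l.length + ofBits l := by
  induction l generalizing n with
  | nil => simp [ofBits]
  | cons b l ih =>
    rw [ofBits, List.foldl_cons, List.foldl_cons, ih, ih (Nat.bit b 0), List.length_cons, pow_succ,
      Nat.bit_val, Nat.bit_val]
    ring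

theorem ofBits_cons (b : Bool) (l : List Bool) :
    ofBits (b :: l) = b.toNat * 2 ^ l.length + ofBits l := by
  rw [ofBits, List.foldl_cons, foldl_bit]
  cases b <;> rfl

theorem ofBits_lt (l : List Bool) : ofBits l < 2 ^ l.length := by
  induction l with
  | nil => simp [ofBits]
  | cons b l ih =>
    rw [ofBits_cons, List.length_cons, pow_succ]
    cases b <;> simp <;> omega

/-- One step of addition (or of subtraction, if `sub` is true) of binary numbers: the state consists
of the remaining digits, the carry and the digits of the result. -/
def rippleStep (sub : Bool) (s : ℕ × ℕ × Bool × List Bool) : ℕ × ℕ × Bool × List Bool :=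
  (s.1.div2, s.2.1.div2,
    bif s.1.bodd ^^ sub then s.2.1.bodd || s.2.2.1 else s.2.1.bodd && s.2.2.1,
    (s.1.bodd ^^ (s.2.1.bodd ^^ s.2.2.1)) :: s.2.2.2)

/-- Addition or subtraction of binary numbers. -/
def ripple (sub : Bool) (x y : ℕ) : ℕ × ℕ × Bool × List Bool :=
  (x.bits ++ y.bits ++ [true]).foldl (fun s _ => rippleStep sub s) (x, y, false, [])

/-- The invariant is the value (x ± (y + c)) · 2^k + d, where c is the carry or borrow and d the
number formed by the k digits already produced. One step preserves it by a check of the cases of two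
low bits, carry and sign. -/
theorem foldl_rippleStep (sub : Bool) (l : List Bool) : ∀ (x y : ℕ) (c : Bool) (d : List Bool),
    ∃ x' y' c' d', l.foldl (fun s _ => rippleStep sub s) (x, y, c, d) = (x', y', c', d') ∧
      x' = x / 2 ^ l.length ∧ y' = y / 2 ^ l.length ∧ d'.length = d.length + l.length ∧
      ((x : ℤ) + (bif sub then -1 else 1) * (y + c.toNat)) * 2 ^ d.length + ofBits d =
        ((x' : ℤ) + (bif sub then -1 else 1) * (y' + c'.toNat)) * 2 ^ d'.length + ofBits d' := by
  induction l with
  | nil => intro x y c d; exact ⟨x, y, c, d, rfl, by simp, by simp, by simp, rfl⟩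
  | cons b l ih =>
    intro x y c d
    obtain ⟨x', y', c', d', h, hx, hy, hd, hv⟩ := ih x.div2 y.div2
      (bif x.bodd ^^ sub then y.bodd || c else y.bodd && c) ((x.bodd ^^ (y.bodd ^^ c)) :: d)
    refine ⟨x', y', c', d', h, ?_, ?_, ?_, ?_⟩
    · rw [hx, Nat.div2_val, Nat.div_div_eq_div_mul, List.length_cons, pow_succ']
    · rw [hy, Nat.div2_val, Nat.div_div_eq_div_mul, List.length_cons, pow_succ']
    · rw [hd, List.length_cons, List.length_cons]
      omega
    · rw [← hv, ofBits_cons, List.length_cons, pow_succ]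
      have h₁ := Nat.bodd_add_div2 x
      have h₂ := Nat.bodd_add_div2 y
      generalize x.bodd = p at *
      generalize y.bodd = q at *
      generalize x.div2 = u at *
      generalize y.div2 = v at *
      subst h₁ h₂
      cases p <;> cases q <;> cases c <;> cases sub <;> simp <;> ring

/-- The list folded over only serves as a step counter. After `x.size + y.size + 1` steps both
inputs are used up, and the invariant leaves only the last carry and the digits. -/
theorem ripple_spec (sub : Bool) (x y : ℕ) : ∃ c d, (ripple sub x y).2.2 = (c, d) ∧
    x < 2 ^ d.length ∧ y < 2 ^ d.length ∧ x + y < 2 ^ d.length ∧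
      (x : ℤ) + (bif sub then -1 else 1) * y =
        (bif sub then -1 else 1) * c.toNat * 2 ^ d.length + ofBits d := by
  obtain ⟨x', y', c, d, h, hx, hy, hd, hv⟩ :=
    foldl_rippleStep sub (x.bits ++ y.bits ++ [true]) x y false []
  have hl : (x.bits ++ y.bits ++ [true]).length = x.size + y.size + 1 := by
    simp [add_assoc, Nat.size_eq_bits_len]
  rw [hl] at hx hy hd
  simp only [List.length_nil, zero_add] at hd
  have h₁ : x + y < 2 ^ (x.size + y.size + 1) :=
    (Nat.lt_size_self _).trans_le (Nat.pow_le_pow_right (by omega) (Nat.size_add_le x y))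
  rw [Nat.div_eq_of_lt (by omega)] at hx hy
  subst hx hy
  refine ⟨c, d, by rw [ripple, h], by rw [hd]; omega, by rw [hd]; omega, by rw [hd]; omega, ?_⟩
  simpa [ofBits] using hv

theorem ofBits_ripple_add (x y : ℕ) : ofBits (ripple false x y).2.2.2 = x + y := by
  obtain ⟨c, d, h, -, -, hxy, hv⟩ := ripple_spec false x y
  rw [h]
  have := ofBits_lt d
  cases c
  · simp at hv
    dsimp only
    omega
  · simp at hv
    have h₂ : ((2 ^ d.length : ℕ) : ℤ) = 2 ^ d.length := by push_cast; rfl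
    omega

/-- As the digits represent a number below 2^k, a final borrow means x < y, where truncated
subtraction gives 0. -/
theorem ofBits_ripple_sub (x y : ℕ) :
    (bif (ripple true x y).2.2.1 then 0 else ofBits (ripple true x y).2.2.2) = x - y := by
  obtain ⟨c, d, h, -, -, hxy, hv⟩ := ripple_spec true x y
  rw [h]
  have := ofBits_lt d
  cases c
  · simp at hv
    simp only [cond_false]
    omega
  · simp at hv
    have h₂ : ((2 ^ d.length : ℕ) : ℤ) = 2 ^ d.length := by push_cast; rfl
    simp only [cond_true]
    omega

theorem foldr_bits_mul (x y : ℕ) :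
    x.bits.foldr (fun b n => n + n + (bif b then y else 0)) 0 = x * y := by
  induction x using Nat.binaryRec' with
  | zero => simp
  | bit b n h ih =>
    rw [Nat.bits_append_bit n b h, List.foldr_cons, ih, Nat.bit_val]
    cases b <;> simp <;> ring

/-! ### Arithmetic in polynomial time -/

namespace PolyTime

@[fun_prop]
theorem not {f : α → Bool} (hf : PolyTime f) : PolyTime fun a => !(f a) := by
  convert hf.cond (const false) (const true) using 2 with a
  cases f a <;> rfl

@[fun_prop]
theorem and {f g : α → Bool} (hf : PolyTime f) (hg : PolyTime g) :
    PolyTime fun a => f a && g a := by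
  convert hf.cond hg (const false) using 2 with a
  cases f a <;> rfl

@[fun_prop]
theorem or {f g : α → Bool} (hf : PolyTime f) (hg : PolyTime g) :
    PolyTime fun a => f a || g a := by
  convert hf.cond (const true) hg using 2 with a
  cases f a <;> rfl

@[fun_prop]
theorem xor {f g : α → Bool} (hf : PolyTime f) (hg : PolyTime g) :
    PolyTime fun a => f a ^^ g a := by
  convert hf.cond hg.not hg using 2 with a
  cases f a <;> simp

theorem nat_of_bits {f : α → ℕ} (hf : PolyTime fun a => (f a).bits) : PolyTime f := hf

@[fun_prop]
theorem bits {f : α → ℕ} (hf : PolyTime f) : PolyTime fun a => (f a).bits := hf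

@[fun_prop]
theorem div2 {f : α → ℕ} (hf : PolyTime f) : PolyTime fun a => (f a).div2 :=
  nat_of_bits (by simpa only [Nat.div2_bits_eq_tail] using hf.bits.list_tail)

@[fun_prop]
theorem bodd {f : α → ℕ} (hf : PolyTime f) : PolyTime fun a => (f a).bodd := by
  convert hf.bits.list_headD false using 2 with a
  rw [Nat.bodd_eq_bits_head]
  cases (f a).bits <;> rfl

@[fun_prop]
theorem nat_eq_zero {f : α → ℕ} (hf : PolyTime f) : PolyTime fun a => decide (f a = 0) := by
  convert hf.bits.list_isEmpty using 2 with a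
  have h : f a = 0 ↔ (f a).bits.length = 0 := by rw [Nat.size_eq_bits_len, Nat.size_eq_zero]
  rw [Bool.eq_iff_iff, decide_eq_true_iff, h]
  generalize (f a).bits = l
  cases l <;> simp

-- `Nat.bits` has no leading zeros, so appending the bit 0 to the number 0 must leave the empty
-- list.
@[fun_prop]
theorem bit {f : α → ℕ} {b : α → Bool} (hb : PolyTime b) (hf : PolyTime f) :
    PolyTime fun a => Nat.bit (b a) (f a) := by
  refine nat_of_bits ?_
  have : PolyTime fun a => bif (f a).bits.isEmpty && !(b a) then [] else b a :: (f a).bits := by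
    fun_prop
  convert this using 2 with a
  by_cases h : f a = 0 → b a = true
  · rw [Nat.bits_append_bit _ _ h]
    have : (f a).bits.isEmpty = true → b a = true := fun h' => h (by
      rw [← Nat.size_eq_zero, ← Nat.size_eq_bits_len, List.isEmpty_iff.1 h']
      rfl)
    cases h₁ : (f a).bits.isEmpty
    · simp
    · simp [this h₁]
  · push Not at h
    simp only [Bool.not_eq_true] at h
    simp [h.1, h.2]

@[fun_prop]
theorem ofBits {f : α → List Bool} (hf : PolyTime f) : PolyTime fun a => ofBits (f a) := by
  unfold TreeProg.ofBits
  refine foldl_of_growth (f := fun _ n b => Nat.bit b n) hf (by fun_prop) (by fun_prop) (.const 6)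
    fun a n b _ => ?_
  have : (Nat.bit b n).size ≤ n.size + 1 := by
    rw [Nat.size_le, Nat.bit_val, pow_succ]
    have := n.lt_size_self
    cases b <;> simp <;> omega
  simp only [size_nat]
  omega

@[fun_prop]
theorem ripple (sub : Bool) {f g : α → ℕ} (hf : PolyTime f) (hg : PolyTime g) :
    PolyTime fun a => ripple sub (f a) (g a) := by
  unfold TreeProg.ripple
  refine foldl_of_growth (f := fun _ s _ => rippleStep sub s) (by fun_prop) (by fun_prop)
    ?_ (.const 6) ?_
  · unfold rippleStep
    fun_prop
  · rintro a ⟨x, y, c, d⟩ - -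
    have h₁ := size_nat_le_of_le (show x.div2 ≤ x by rw [Nat.div2_val]; omega)
    have h₂ := size_nat_le_of_le (show y.div2 ≤ y by rw [Nat.div2_val]; omega)
    simp only [rippleStep, size_pair, size_cons, size_bool]
    omega

@[fun_prop]
theorem nat_add {f g : α → ℕ} (hf : PolyTime f) (hg : PolyTime g) :
    PolyTime fun a => f a + g a := by
  simp only [← ofBits_ripple_add]
  fun_prop

@[fun_prop]
theorem nat_sub {f g : α → ℕ} (hf : PolyTime f) (hg : PolyTime g) :
    PolyTime fun a => f a - g a := by
  simp only [← ofBits_ripple_sub]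
  fun_prop

@[fun_prop]
theorem nat_mul {f g : α → ℕ} (hf : PolyTime f) (hg : PolyTime g) :
    PolyTime fun a => f a * g a := by
  have : PolyTime fun a => (f a).bits.reverse.foldl (fun n b => n + n + bif b then g a else 0) 0 := by
    refine foldl (f := fun a n b => n + n + bif b then g a else 0) (by fun_prop) (by fun_prop) ?_
      (hf.size.add hg.size) ?_
    · have := hg.comp (f := fun p : α × ℕ × Bool => p.1) (by fun_prop)
      fun_prop
    · intro a l₁ l₂ h
      -- In Horner's scheme the partial results never decrease, so each is at most the final
      -- product.
      refine (size_nat_le_of_le ?_).trans (size_nat_mul_le (f a) (g a))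
      rw [← foldr_bits_mul, ← List.foldl_reverse, h, List.foldl_append]
      generalize l₁.foldl _ 0 = n
      clear h
      induction l₂ generalizing n with
      | nil => exact le_rfl
      | cons b l ih => exact le_trans (show n ≤ n + n + bif b then g a else 0 by omega) (ih _)
  simpa only [List.foldl_reverse, foldr_bits_mul] using this

theorem int_of_nat {f : α → ℤ} (h₁ : PolyTime fun a => (f a).toNat)
    (h₂ : PolyTime fun a => (-(f a)).toNat) : PolyTime f :=
  (h₁.prodMk h₂ : PolyTime fun a => ((f a).toNat, (-(f a)).toNat))

@[fun_prop]
theorem toNat {f : α → ℤ} (hf : PolyTime f) : PolyTime fun a => (f a).toNat :=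
  fst (show PolyTime fun a => ((f a).toNat, (-(f a)).toNat) from hf)

theorem toNat_neg {f : α → ℤ} (hf : PolyTime f) : PolyTime fun a => (-(f a)).toNat :=
  snd (show PolyTime fun a => ((f a).toNat, (-(f a)).toNat) from hf)

@[fun_prop]
theorem int_neg {f : α → ℤ} (hf : PolyTime f) : PolyTime fun a => -(f a) :=
  int_of_nat hf.toNat_neg (by simpa using hf.toNat)

@[fun_prop]
theorem int_cast {f : α → ℕ} (hf : PolyTime f) : PolyTime fun a => (f a : ℤ) :=
  int_of_nat (by simpa using hf) (by simpa using const 0)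

@[fun_prop]
theorem int_eq_zero {f : α → ℤ} (hf : PolyTime f) : PolyTime fun a => decide (f a = 0) := by
  convert hf.toNat.nat_eq_zero.and hf.toNat_neg.nat_eq_zero using 2 with a
  rw [← Bool.decide_and, decide_eq_decide]
  omega

@[fun_prop]
theorem int_add {f g : α → ℤ} (hf : PolyTime f) (hg : PolyTime g) :
    PolyTime fun a => f a + g a := by
  have h₁ := hf.toNat_neg
  have h₂ := hg.toNat_neg
  have h₃ : PolyTime fun a =>
    ((f a).toNat + (g a).toNat - ((-(f a)).toNat + (-(g a)).toNat)) := by fun_prop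
  have h₄ : PolyTime fun a =>
    ((-(f a)).toNat + (-(g a)).toNat - ((f a).toNat + (g a).toNat)) := by fun_prop
  refine int_of_nat ?_ ?_
  · convert h₃ using 2 with a
    omega
  · convert h₄ using 2 with a
    omega

/-- One of the two parts of each factor vanishes, so there is no cancellation. -/
theorem toNat_mul_eq (x y : ℤ) :
    (x * y).toNat = x.toNat * y.toNat + (-x).toNat * (-y).toNat := by
  rcases le_total 0 x with hx | hx <;> rcases le_total 0 y with hy | hy
  · rw [Int.toNat_mul hx hy, Int.toNat_eq_zero.2 (show -x ≤ 0 by omega)]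
    simp
  · rw [Int.toNat_eq_zero.2 (mul_nonpos_of_nonneg_of_nonpos hx hy), Int.toNat_eq_zero.2 hy,
      Int.toNat_eq_zero.2 (show -x ≤ 0 by omega)]
    simp
  · rw [Int.toNat_eq_zero.2 (mul_nonpos_of_nonpos_of_nonneg hx hy), Int.toNat_eq_zero.2 hx,
      Int.toNat_eq_zero.2 (show -y ≤ 0 by omega)]
    simp
  · rw [← neg_mul_neg, Int.toNat_mul (by omega) (by omega), Int.toNat_eq_zero.2 hx]
    simp

@[fun_prop]
theorem int_mul {f g : α → ℤ} (hf : PolyTime f) (hg : PolyTime g) :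
    PolyTime fun a => f a * g a := by
  have h₁ := hf.toNat_neg
  have h₂ := hg.toNat_neg
  refine int_of_nat ?_ ?_
  · simp only [toNat_mul_eq]
    fun_prop
  · simp only [← neg_mul, toNat_mul_eq, neg_neg]
    fun_prop

end PolyTime

end TreeProg

/-! ### Linear algebra with lists of integers -/

namespace TreeProg

open StackProg Reg TreeEncodable

variable {α β γ σ : Type} [TreeEncodable α] [TreeEncodable β] [TreeEncodable γ] [TreeEncodable σ]

/-- The dot product. -/
def dot (u v : List ℤ) : ℤ := (List.zipWith (fun x y => x * y) u v).sum

/-- The product of a matrix, given as the list of its rows, and a vector. -/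
def mulVec (M : List (List ℤ)) (v : List ℤ) : List ℤ := M.map fun r => dot r v

/-- The Kronecker product of two vectors. -/
def kronVec (u v : List ℤ) : List ℤ := u.flatMap fun x => v.map fun y => x * y

/-- The Kronecker product of two matrices. -/
def kronMat (A B : List (List ℤ)) : List (List ℤ) := A.flatMap fun r => B.map fun s => kronVec r s

/-- The image of a vector under the sum of a scalar and some matrices. -/
def step (c : ℤ) (Bs : List (List (List ℤ))) (v : List ℤ) : List ℤ :=
  Bs.foldl (fun w B => List.zipWith (fun x y => x + y) w (mulVec B v)) (v.map fun x => c * x)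

/-- The iterated image of a vector under the sum of a scalar and some matrices, where the number of
iterations is the length of the vector. -/
def iterateStep (c : ℤ) (Bs : List (List (List ℤ))) (v : List ℤ) : List ℤ :=
  v.foldl (fun w _ => step c Bs w) v

/-- One step of computing a common denominator. -/
def scaleStep (s : ℕ × List ℤ) (p : ℤ × ℕ) : ℕ × List ℤ :=
  (s.1 * p.2, (p.1 * s.1) :: s.2.map fun x => x * p.2)

/-- Common denominators: a list of fractions `a / b` is transformed into the product `D` of all
denominators and the list of all integers `D * a / b`, the latter in reverse order. -/
def scale (l : List (ℤ × ℕ)) : ℕ × List ℤ :=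
  l.foldl scaleStep (1, [])

/-- The sum of the absolute values of the entries of a vector. -/
def norm1 (v : List ℤ) : ℕ := (v.map Int.natAbs).sum

/-- An upper bound for the norm of `step c Bs`. -/
def stepNorm (c : ℤ) (Bs : List (List (List ℤ))) : ℕ :=
  c.natAbs + (Bs.map fun B => (B.map norm1).sum).sum

theorem norm1_cons (x : ℤ) (v : List ℤ) : norm1 (x :: v) = x.natAbs + norm1 v := rfl

theorem natAbs_le_norm1 {x : ℤ} {v : List ℤ} (h : x ∈ v) : x.natAbs ≤ norm1 v :=
  List.le_sum_of_mem (List.mem_map_of_mem h)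

theorem size_le_of_norm1_le {v : List ℤ} {m n : ℕ} (hn : norm1 v ≤ n) (hm : v.length ≤ m) :
    size v ≤ m * (2 * size n + 2) + 1 := by
  refine (size_le_of_forall (n := 2 * size n + 1) fun x hx => size_int_le
    ((natAbs_le_norm1 hx).trans hn)).trans ?_
  exact Nat.add_le_add_right (Nat.mul_le_mul_right _ hm) 1

theorem natAbs_dot_le : ∀ u v : List ℤ, (dot u v).natAbs ≤ norm1 u * norm1 v
  | [], v => by simp [dot]
  | x :: u, [] => by simp [dot]
  | x :: u, y :: v => by
    have h := natAbs_dot_le u v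
    have h₁ : dot (x :: u) (y :: v) = x * y + dot u v := rfl
    rw [h₁, norm1_cons, norm1_cons]
    refine (Int.natAbs_add_le _ _).trans ?_
    rw [Int.natAbs_mul]
    nlinarith [Nat.zero_le (x.natAbs * norm1 v), Nat.zero_le (norm1 u * y.natAbs)]

theorem norm1_mulVec_le (M : List (List ℤ)) (v : List ℤ) :
    norm1 (mulVec M v) ≤ (M.map norm1).sum * norm1 v := by
  induction M with
  | nil => simp [mulVec, norm1]
  | cons r M ih =>
    have := natAbs_dot_le r v
    simp only [mulVec, List.map_cons, norm1_cons, List.sum_cons, add_mul] at ih ⊢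
    omega

theorem norm1_zipWith_add_le : ∀ u v : List ℤ,
    norm1 (List.zipWith (fun x y => x + y) u v) ≤ norm1 u + norm1 v
  | [], v => by simp [norm1]
  | x :: u, [] => by simp [norm1]
  | x :: u, y :: v => by
    have h := norm1_zipWith_add_le u v
    simp only [List.zipWith_cons_cons, norm1_cons]
    omega

theorem norm1_map_mul (c : ℤ) (v : List ℤ) :
    norm1 (v.map fun x => c * x) = c.natAbs * norm1 v := by
  induction v with
  | nil => simp [norm1]
  | cons x v ih => simp only [List.map_cons, norm1_cons, ih, Int.natAbs_mul, mul_add]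

/-- `stepNorm` bounds the ℓ¹ operator norm, and lengths cannot grow because `zipWith` truncates. -/
theorem norm1_step_le (c : ℤ) (Bs : List (List (List ℤ))) (v : List ℤ) :
    norm1 (step c Bs v) ≤ stepNorm c Bs * norm1 v ∧ (step c Bs v).length ≤ v.length := by
  have key : ∀ (Bs : List (List (List ℤ))) (w : List ℤ), norm1 (Bs.foldl (fun w B =>
      List.zipWith (fun x y => x + y) w (mulVec B v)) w) ≤
        norm1 w + (Bs.map fun B => (B.map norm1).sum).sum * norm1 v ∧
      (Bs.foldl (fun w B => List.zipWith (fun x y => x + y) w (mulVec B v)) w).length ≤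
        w.length := by
    intro Bs
    induction Bs with
    | nil => intro w; simp
    | cons B Bs ih =>
      intro w
      have h := ih (List.zipWith (fun x y => x + y) w (mulVec B v))
      have h₁ := norm1_zipWith_add_le w (mulVec B v)
      have h₂ := norm1_mulVec_le B v
      simp only [List.length_zipWith] at h
      simp only [List.map_cons, List.sum_cons, add_mul, List.foldl_cons]
      omega
  have h := key Bs (v.map fun x => c * x)
  rw [norm1_map_mul, ← add_mul] at h
  exact ⟨h.1, h.2.trans (by simp)⟩

theorem stepNorm_append_le (c : ℤ) (Bs Cs : List (List (List ℤ))) :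
    stepNorm c Bs ≤ stepNorm c (Bs ++ Cs) := by
  simp [stepNorm]

theorem norm1_foldl_step_le (c : ℤ) (Bs : List (List (List ℤ))) (l : List ℤ) (v : List ℤ) :
    norm1 (l.foldl (fun w _ => step c Bs w) v) ≤ stepNorm c Bs ^ l.length * norm1 v ∧
      (l.foldl (fun w _ => step c Bs w) v).length ≤ v.length := by
  induction l generalizing v with
  | nil => simp
  | cons x l ih =>
    obtain ⟨h₁, h₂⟩ := ih (step c Bs v)
    obtain ⟨h₃, h₄⟩ := norm1_step_le c Bs v
    refine ⟨h₁.trans ?_, h₂.trans h₄⟩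
    rw [List.length_cons, pow_succ, mul_assoc]
    exact Nat.mul_le_mul_left _ h₃

/-- After k iterations the norm may be C^k times the initial one, which costs only k times the size
of C in bits. This keeps the iteration polynomial. -/
theorem size_pow_mul_le (C k n : ℕ) : size (C ^ k * n) ≤ k * size C + size n := by
  induction k with
  | zero => simp
  | succ k ih =>
    rw [pow_succ', mul_assoc, add_mul]
    have := size_nat_mul_le C (C ^ k * n)
    omega

/-! ### Linear algebra in polynomial time -/

namespace PolyTime

@[fun_prop]
theorem natAbs {f : α → ℤ} (hf : PolyTime f) : PolyTime fun a => (f a).natAbs := by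
  have h₁ := hf.toNat_neg
  have : PolyTime fun a => (f a).toNat + (-(f a)).toNat := by fun_prop
  convert this using 2 with a
  omega

@[fun_prop]
theorem list_sum_nat {l : α → List ℕ} (hl : PolyTime l) : PolyTime fun a => (l a).sum := by
  simp only [List.sum_eq_foldl]
  refine foldl_of_growth (f := fun _ x y => x + y) hl (by fun_prop) (by fun_prop)
    (hl.size.add (.const 5)) fun a x y hy => ?_
  have h₁ := size_nat_add_le x y
  have h₂ := size_le_of_mem hy
  omega

@[fun_prop]
theorem list_prod_nat {l : α → List ℕ} (hl : PolyTime l) : PolyTime fun a => (l a).prod := by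
  simp only [List.prod_eq_foldl]
  refine foldl_of_growth (f := fun _ x y => x * y) hl (by fun_prop) (by fun_prop)
    hl.size fun a x y hy => ?_
  have h₁ := size_nat_mul_le x y
  have h₂ := size_le_of_mem hy
  omega

@[fun_prop]
theorem list_sum_int {l : α → List ℤ} (hl : PolyTime l) : PolyTime fun a => (l a).sum := by
  simp only [List.sum_eq_foldl]
  refine foldl_of_growth (f := fun _ x y => x + y) hl (by fun_prop) (by fun_prop)
    (hl.size.add (.const 10)) fun a x y hy => ?_
  have h₁ := size_nat_le_of_le (show (x + y).toNat ≤ x.toNat + y.toNat by omega)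
  have h₂ := size_nat_le_of_le (show (-(x + y)).toNat ≤ (-x).toNat + (-y).toNat by omega)
  have h₃ := size_nat_add_le x.toNat y.toNat
  have h₄ := size_nat_add_le (-x).toNat (-y).toNat
  have h₅ := size_le_of_mem hy
  rw [size_int] at h₅ ⊢
  rw [size_int x]
  omega

@[fun_prop]
theorem dot {u v : α → List ℤ} (hu : PolyTime u) (hv : PolyTime v) :
    PolyTime fun a => dot (u a) (v a) := by
  unfold TreeProg.dot
  exact list_sum_int (list_zipWith (f := fun _ x y => x * y) hu hv (by fun_prop))

@[fun_prop]
theorem mulVec {M : α → List (List ℤ)} {v : α → List ℤ} (hM : PolyTime M) (hv : PolyTime v) :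
    PolyTime fun a => mulVec (M a) (v a) :=
  list_map (f := fun a r => TreeProg.dot r (v a)) hM
    (by have := hv.comp (f := fun p : α × List ℤ => p.1) (by fun_prop); fun_prop)

@[fun_prop]
theorem kronVec {u v : α → List ℤ} (hu : PolyTime u) (hv : PolyTime v) :
    PolyTime fun a => kronVec (u a) (v a) :=
  list_flatMap (f := fun a x => (v a).map fun y => x * y) hu
    (list_map (α := α × ℤ) (l := fun p => v p.1) (f := fun p y => p.2 * y) (hv.comp fst')
      (by fun_prop))

@[fun_prop]
theorem kronMat {A B : α → List (List ℤ)} (hA : PolyTime A) (hB : PolyTime B) :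
    PolyTime fun a => kronMat (A a) (B a) :=
  list_flatMap (f := fun a r => (B a).map fun s => TreeProg.kronVec r s) hA
    (list_map (α := α × List ℤ) (l := fun p => B p.1) (f := fun p s => TreeProg.kronVec p.2 s)
      (hB.comp fst') (by fun_prop))

@[fun_prop]
theorem norm1 {v : α → List ℤ} (hv : PolyTime v) : PolyTime fun a => norm1 (v a) :=
  list_sum_nat (list_map (f := fun _ x => x.natAbs) hv (by fun_prop))

@[fun_prop]
theorem stepNorm {c : α → ℤ} {Bs : α → List (List (List ℤ))} (hc : PolyTime c)
    (hB : PolyTime Bs) : PolyTime fun a => stepNorm (c a) (Bs a) :=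
  nat_add (by fun_prop) (list_sum_nat (list_map (f := fun _ B => (B.map TreeProg.norm1).sum) hB
    (list_sum_nat (list_map (f := fun _ r => TreeProg.norm1 r) (by fun_prop) (by fun_prop)))))

@[fun_prop]
theorem step {c : α → ℤ} {Bs : α → List (List (List ℤ))} {v : α → List ℤ} (hc : PolyTime c)
    (hB : PolyTime Bs) (hv : PolyTime v) : PolyTime fun a => step (c a) (Bs a) (v a) := by
  have h₁ : PolyTime fun a => TreeProg.stepNorm (c a) (Bs a) * TreeProg.norm1 (v a) := by fun_prop
  refine foldl (f := fun a w B => List.zipWith (fun x y => x + y) w (TreeProg.mulVec B (v a))) hB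
    (list_map (f := fun a x => c a * x) hv ?_) ?_
    ((hv.size.mul (((PolyBdd.const 2).mul h₁.size).add (.const 2))).add (.const 1)) ?_
  · have := hc.comp (f := fun p : α × ℤ => p.1) (by fun_prop)
    fun_prop
  · have := hv.comp (f := fun p : α × List ℤ × List (List ℤ) => p.1) (by fun_prop)
    exact list_zipWith (f := fun _ x y => x + y) (by fun_prop) (by fun_prop) (by fun_prop)
  · intro a l₁ l₂ h
    -- The partial result after the prefix `l₁` is itself `step (c a) l₁ (v a)`.
    obtain ⟨h₂, h₃⟩ := norm1_step_le (c a) l₁ (v a)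
    have h₄ := stepNorm_append_le (c a) l₁ l₂
    rw [← h] at h₄
    exact size_le_of_norm1_le (h₂.trans (Nat.mul_le_mul_right _ h₄))
      (h₃.trans (length_lt_size _).le)

@[fun_prop]
theorem iterateStep {c : α → ℤ} {Bs : α → List (List (List ℤ))} {v : α → List ℤ} (hc : PolyTime c)
    (hB : PolyTime Bs) (hv : PolyTime v) : PolyTime fun a => iterateStep (c a) (Bs a) (v a) := by
  have h₁ : PolyTime fun a => TreeProg.stepNorm (c a) (Bs a) := by fun_prop
  have h₂ : PolyTime fun a => TreeProg.norm1 (v a) := by fun_prop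
  refine foldl (f := fun a w _ => TreeProg.step (c a) (Bs a) w) hv hv ?_
    ((hv.size.mul (((PolyBdd.const 2).mul ((hv.size.mul h₁.size).add h₂.size)).add
      (.const 2))).add (.const 1)) ?_
  · have := hc.comp (f := fun p : α × List ℤ × ℤ => p.1) (by fun_prop)
    have := hB.comp (f := fun p : α × List ℤ × ℤ => p.1) (by fun_prop)
    fun_prop
  · intro a l₁ l₂ h
    obtain ⟨h₃, h₄⟩ := norm1_foldl_step_le (c a) (Bs a) l₁ (v a)
    have h₅ : l₁.length ≤ TreeProg.size (v a) := by
      have := length_lt_size (v a)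
      rw [h] at this ⊢
      simp only [List.length_append] at this
      omega
    refine (size_le_of_norm1_le h₃ (h₄.trans (length_lt_size _).le)).trans ?_
    have h₆ := (size_pow_mul_le (TreeProg.stepNorm (c a) (Bs a)) l₁.length
      (TreeProg.norm1 (v a))).trans (Nat.add_le_add_right (Nat.mul_le_mul_right _ h₅) _)
    exact Nat.add_le_add_right (Nat.mul_le_mul_left _
      (Nat.add_le_add_right (Nat.mul_le_mul_left _ h₆) _)) _

@[fun_prop]
theorem scale {l : α → List (ℤ × ℕ)} (hl : PolyTime l) : PolyTime fun a => scale (l a) := by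
  have h₁ : PolyTime fun a => ((l a).map fun p => p.1.natAbs + p.2 + 1).prod :=
    list_prod_nat (list_map (f := fun _ p => p.1.natAbs + p.2 + 1) hl (by fun_prop))
  refine foldl (f := fun _ s p => scaleStep s p)
    hl (by fun_prop) ?_
    ((h₁.size.add ((hl.size.mul (((PolyBdd.const 2).mul h₁.size).add (.const 2))).add
      (.const 1))).add (.const 1)) ?_
  · have := list_map (α := α × (ℕ × List ℤ) × ℤ × ℕ) (l := fun p => p.2.1.2)
      (f := fun p (x : ℤ) => x * (p.2.2.2 : ℤ)) (by fun_prop) (by fun_prop)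
    unfold scaleStep
    fun_prop
  · intro a l₁ l₂ h
    -- Reading a fraction multiplies the bound on all integers by |a| + b + 1, which covers both the
    -- rescaling by b and the new numerator. The summand 1 makes the factors positive, so the
    -- product over a prefix is at most that over the whole list.
    have key : ∀ (l₁ : List (ℤ × ℕ)) (s : ℕ × List ℤ) (n : ℕ), s.1 ≤ n →
        (∀ x ∈ s.2, x.natAbs ≤ n) →
        (l₁.foldl scaleStep s).1 ≤
          n * (l₁.map fun p => p.1.natAbs + p.2 + 1).prod ∧
        (∀ x ∈ (l₁.foldl scaleStep s).2,
          x.natAbs ≤ n * (l₁.map fun p => p.1.natAbs + p.2 + 1).prod) ∧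
        (l₁.foldl scaleStep s).2.length =
          s.2.length + l₁.length := by
      intro l₁
      induction l₁ with
      | nil => intro s n h₁ h₂; simpa using ⟨h₁, h₂⟩
      | cons p l₁ ih =>
        intro s n h₁ h₂
        have h₃ := ih (scaleStep s p)
          (n * (p.1.natAbs + p.2 + 1)) (Nat.mul_le_mul h₁ (by omega)) (by
            intro x hx
            simp only [scaleStep, List.mem_cons, List.mem_map] at hx
            rcases hx with rfl | ⟨y, hy, rfl⟩
            · rw [Int.natAbs_mul, mul_comm]
              exact Nat.mul_le_mul (by simpa using h₁) (by omega)
            · rw [Int.natAbs_mul]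
              exact Nat.mul_le_mul (h₂ y hy) (by simp; omega))
        simp only [List.map_cons, List.prod_cons, ← mul_assoc, List.foldl_cons]
        refine ⟨h₃.1, h₃.2.1, h₃.2.2.trans ?_⟩
        simp only [scaleStep, List.length_cons, List.length_map]
        omega
    obtain ⟨h₂, h₃, h₄⟩ := key l₁ (1, []) 1 le_rfl (by simp)
    have h₅ : (l₁.map fun p => p.1.natAbs + p.2 + 1).prod ≤
        ((l a).map fun p => p.1.natAbs + p.2 + 1).prod := by
      rw [h, List.map_append, List.prod_append]
      refine Nat.le_mul_of_pos_right _ (List.prod_pos ?_)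
      simp only [List.mem_map]
      rintro x ⟨p, -, rfl⟩
      omega
    have h₆ : l₁.length ≤ TreeProg.size (l a) := by
      have := length_lt_size (l a)
      rw [h] at this ⊢
      simp only [List.length_append] at this
      omega
    generalize (l₁.foldl scaleStep (1, [])) = s at *
    obtain ⟨D, v⟩ := s
    simp only [one_mul, List.length_nil, zero_add] at h₂ h₃ h₄
    rw [size_pair]
    refine Nat.add_le_add_right (Nat.add_le_add (size_nat_le_of_le (h₂.trans h₅))
      ((size_le_of_forall fun x hx => size_int_le ((h₃ x hx).trans h₅)).trans ?_)) _
    rw [h₄]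
    exact Nat.add_le_add_right (Nat.mul_le_mul_right _ h₆) _

end PolyTime

/-- A matrix with one more row and one more column. -/
def border (D : ℤ) (z : List ℤ) (M : List (List ℤ)) : List (List ℤ) :=
  (M.map fun r => r ++ [0]) ++ [z ++ [D]]

/-- The decision procedure for an automaton given by integers with a common denominator `D`. -/
def core (D : ℤ) (α η : List ℤ) (Ms : List (List (List ℤ))) : Bool :=
  decide (dot (kronVec (kronVec (α ++ [0]) (α ++ [-D])) (kronVec (α ++ [0]) (α ++ [-D])))
    (iterateStep (D * D * (D * D))
      (Ms.map fun M => kronMat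
        (kronMat (border D (α.map fun _ => 0) M) (border D (α.map fun _ => 0) M))
        (kronMat (border D (α.map fun _ => 0) M) (border D (α.map fun _ => 0) M)))
      (kronVec (kronVec (η ++ [D]) (η ++ [D])) (kronVec (η ++ [D]) (η ++ [D])))) = 0)

/-- The decision procedure for an automaton given by the number of states in unary and the list of
all entries. -/
def decideEntries (n : List Bool) (l : List (ℤ × ℕ)) : Bool :=
  -- Rows of length n: the first is the initial vector, the second the final vector, and the others,
  -- grouped n at a time, form the matrices.
  core (scale l).1 ((chunk n (scale l).2.reverse).headD [])
    ((chunk n (scale l).2.reverse).tail.headD [])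
    (chunk n (chunk n (scale l).2.reverse).tail.tail)

namespace PolyTime

@[fun_prop]
theorem border {D : α → ℤ} {z : α → List ℤ} {M : α → List (List ℤ)} (hD : PolyTime D)
    (hz : PolyTime z) (hM : PolyTime M) : PolyTime fun a => border (D a) (z a) (M a) :=
  list_append (list_map (f := fun _ r => r ++ [0]) hM (by fun_prop)) (by fun_prop)

@[fun_prop]
theorem core {D : α → ℤ} {v w : α → List ℤ} {Ms : α → List (List (List ℤ))} (hD : PolyTime D)
    (hv : PolyTime v) (hw : PolyTime w) (hM : PolyTime Ms) :
    PolyTime fun a => core (D a) (v a) (w a) (Ms a) := by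
  have h₁ : PolyTime fun a => (v a).map fun _ => (0 : ℤ) :=
    list_map (f := fun _ _ => 0) hv (by fun_prop)
  have h₂ : PolyTime fun p : α × List (List ℤ) =>
      TreeProg.border (D p.1) ((v p.1).map fun _ => 0) p.2 := by
    have h₃ := hD.comp (f := fun p : α × List (List ℤ) => p.1) (by fun_prop)
    have h₄ := h₁.comp (f := fun p : α × List (List ℤ) => p.1) (by fun_prop)
    exact border h₃ h₄ (by fun_prop)
  have h₅ := list_map (f := fun a M => TreeProg.kronMat
        (TreeProg.kronMat (TreeProg.border (D a) ((v a).map fun _ => 0) M)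
          (TreeProg.border (D a) ((v a).map fun _ => 0) M))
        (TreeProg.kronMat (TreeProg.border (D a) ((v a).map fun _ => 0) M)
          (TreeProg.border (D a) ((v a).map fun _ => 0) M))) hM
    ((h₂.kronMat h₂).kronMat (h₂.kronMat h₂))
  unfold TreeProg.core
  fun_prop

@[fun_prop]
theorem decideEntries {n : α → List Bool} {l : α → List (ℤ × ℕ)} (hn : PolyTime n)
    (hl : PolyTime l) : PolyTime fun a => decideEntries (n a) (l a) := by
  unfold TreeProg.decideEntries
  fun_prop

end PolyTime

end TreeProg

/-! ### Reading the input -/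

namespace TreeProg

open StackProg Reg TreeEncodable

variable {α β γ σ : Type} [TreeEncodable α] [TreeEncodable β] [TreeEncodable γ] [TreeEncodable σ]

/-- The symbols of the input as triples of bits. -/
def tok : RatAutomaton.Sym → Bool × Bool × Bool
  | .bit b => (true, b, false)
  | .minus => (false, false, false)
  | .slash => (false, true, false)
  | .comma => (false, false, true)

/-- One step of reading fractions. The state tells whether there was a minus sign and whether there
was a slash, followed by the digits of the current numerator and denominator and by the list of the
fractions that have been read, all in reverse order. -/
def parseStep (s : Bool × Bool × List Bool × List Bool × List (Bool × List Bool × List Bool))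
    (t : Bool × Bool × Bool) :
    Bool × Bool × List Bool × List Bool × List (Bool × List Bool × List Bool) :=
  bif t.1 then
    bif s.2.1 then (s.1, s.2.1, s.2.2.1, t.2.1 :: s.2.2.2.1, s.2.2.2.2)
    else (s.1, s.2.1, t.2.1 :: s.2.2.1, s.2.2.2.1, s.2.2.2.2)
  else bif t.2.2 then (false, false, [], [], (s.1, s.2.2.1, s.2.2.2.1) :: s.2.2.2.2)
  else bif t.2.1 then (s.1, true, s.2.2)
  else (true, s.2)

/-- The list of all fractions in the input. -/
def parse (l : List (Bool × Bool × Bool)) : List (Bool × List Bool × List Bool) :=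
  (l.foldl parseStep (false, false, [], [], [])).2.2.2.2.reverse

/-- The numerator and the denominator of a fraction that has been read. -/
def toEntry (p : Bool × List Bool × List Bool) : ℤ × ℕ :=
  (bif p.1 then -(ofBits p.2.1 : ℤ) else (ofBits p.2.1 : ℤ), ofBits p.2.2)

/-- The decision procedure for the tokens of the input. -/
def decideToks (l : List (Bool × Bool × Bool)) : Bool :=
  decideEntries ((parse l).headD (false, [], [])).2.1 ((parse l).tail.tail.map toEntry)

theorem PolyTime.parse {l : α → List (Bool × Bool × Bool)} (hl : PolyTime l) :
    PolyTime fun a => parse (l a) := by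
  have hstep : PolyTime fun p : α × (Bool × Bool × List Bool × List Bool ×
      List (Bool × List Bool × List Bool)) × Bool × Bool × Bool => parseStep p.2.1 p.2.2 := by
    unfold parseStep
    fun_prop
  refine list_reverse (snd (snd (snd (snd (foldl_of_growth (f := fun _ s t => parseStep s t)
    (s := fun _ => (false, false, [], [], [])) hl (by fun_prop) hstep (.const 20) ?_)))))
  rintro a ⟨b, c, u, v, w⟩ ⟨x, y, z⟩ -
  unfold parseStep
  cases x <;> cases y <;> cases z <;> cases c <;>
    simp only [cond_true, cond_false, size_pair, size_bool, size_cons, size_nil] <;> omega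

theorem PolyTime.decideToks : PolyTime decideToks := by
  have h := PolyTime.parse (PolyTime.id (α := List (Bool × Bool × Bool)))
  have h₁ := list_map (f := fun _ p => toEntry p) (l := fun l => (TreeProg.parse l).tail.tail)
    (by fun_prop) (by unfold toEntry; fun_prop)
  unfold TreeProg.decideToks
  fun_prop

theorem foldl_parseStep_num (b : Bool) (l u v : List Bool)
    (w : List (Bool × List Bool × List Bool)) :
    ((l.map RatAutomaton.Sym.bit).map tok).foldl parseStep (b, false, u, v, w) =
      (b, false, l.reverse ++ u, v, w) := by
  induction l generalizing u with
  | nil => rfl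
  | cons x l ih =>
    simp only [List.map_cons, List.foldl_cons, List.reverse_cons, List.append_assoc]
    exact ih (x :: u)

theorem foldl_parseStep_den (b : Bool) (l u v : List Bool)
    (w : List (Bool × List Bool × List Bool)) :
    ((l.map RatAutomaton.Sym.bit).map tok).foldl parseStep (b, true, u, v, w) =
      (b, true, u, l.reverse ++ v, w) := by
  induction l generalizing v with
  | nil => rfl
  | cons x l ih =>
    simp only [List.map_cons, List.foldl_cons, List.reverse_cons, List.append_assoc]
    exact ih (x :: v)

/-- To the parser, a unary number is a fraction without a slash, whose numerator digits are all
ones. Thus the first two records hold n and m in unary. -/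
theorem foldl_parseStep_unary (k : ℕ) (w : List (Bool × List Bool × List Bool)) :
    ((RatAutomaton.encodeUnary k).map tok).foldl parseStep (false, false, [], [], w) =
      (false, false, [], [], (false, List.replicate k true, []) :: w) := by
  have := foldl_parseStep_num false (List.replicate k true) [] [] w
  rw [List.map_replicate, List.reverse_replicate, List.append_nil] at this
  rw [RatAutomaton.encodeUnary, List.map_append, List.foldl_append, this]
  rfl

/-- The digits arrive least significant first and are collected in reverse, which is the order
`ofBits` expects. -/
theorem foldl_parseStep_rat (q : ℚ) (w : List (Bool × List Bool × List Bool)) :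
    ((RatAutomaton.encodeRat q).map tok).foldl parseStep (false, false, [], [], w) =
      (false, false, [], [], (decide (q < 0), (Computability.encodeNat q.num.natAbs).reverse,
        (Computability.encodeNat q.den).reverse) :: w) := by
  have h₀ : ((if q < 0 then [RatAutomaton.Sym.minus] else []).map tok).foldl parseStep
      (false, false, [], [], w) = (decide (q < 0), false, [], [], w) := by
    by_cases h : q < 0
    · simp only [h, if_true, decide_true]
      rfl
    · simp only [h, if_false, decide_false]
      rfl
  rw [RatAutomaton.encodeRat]
  simp only [List.map_append, List.foldl_append, h₀, RatAutomaton.encodeBinary,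
    foldl_parseStep_num, List.append_nil]
  have h₁ (b : Bool) (u v : List Bool) : List.foldl parseStep (b, false, u, v, w)
      ([RatAutomaton.Sym.slash].map tok) = (b, true, u, v, w) := rfl
  rw [h₁, foldl_parseStep_den, List.append_nil]
  rfl

theorem foldl_parseStep_flatMap (l : List ℚ) (w : List (Bool × List Bool × List Bool)) :
    ((l.flatMap RatAutomaton.encodeRat).map tok).foldl parseStep (false, false, [], [], w) =
      (false, false, [], [], (l.map fun q => (decide (q < 0),
        (Computability.encodeNat q.num.natAbs).reverse,
        (Computability.encodeNat q.den).reverse)).reverse ++ w) := by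
  induction l generalizing w with
  | nil => rfl
  | cons q l ih =>
    rw [List.flatMap_cons, List.map_append, List.foldl_append, foldl_parseStep_rat, ih]
    simp

theorem ofBits_append_singleton (l : List Bool) (b : Bool) :
    ofBits (l ++ [b]) = Nat.bit b (ofBits l) := by
  simp [ofBits]

theorem ofBits_encodePosNum (n : PosNum) :
    ofBits (Computability.encodePosNum n).reverse = (n : ℕ) := by
  induction n with
  | one => rfl
  | bit0 n ih =>
    rw [Computability.encodePosNum, List.reverse_cons, ofBits_append_singleton, ih, PosNum.cast_bit0,
      Nat.bit_val]
    simp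
    omega
  | bit1 n ih =>
    rw [Computability.encodePosNum, List.reverse_cons, ofBits_append_singleton, ih, PosNum.cast_bit1,
      Nat.bit_val]
    simp
    omega

theorem ofBits_encodeNat (n : ℕ) : ofBits (Computability.encodeNat n).reverse = n := by
  have h : ((n : Num) : ℕ) = n := Num.to_of_nat n
  rw [Computability.encodeNat]
  conv_rhs => rw [← h]
  cases (n : Num) with
  | zero => rfl
  | pos p => exact ofBits_encodePosNum p

theorem toEntry_eq (q : ℚ) : toEntry (decide (q < 0),
    (Computability.encodeNat q.num.natAbs).reverse, (Computability.encodeNat q.den).reverse) =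
      (q.num, q.den) := by
  simp only [toEntry, ofBits_encodeNat]
  by_cases h : q < 0
  · have := Rat.num_neg.2 h
    simp only [h, decide_true, cond_true, Prod.mk.injEq, and_true]
    omega
  · have := Rat.num_nonneg.2 (not_lt.1 h)
    simp only [h, decide_false, cond_false, Prod.mk.injEq, and_true]
    omega

end TreeProg

/-! ### The encoding as one flat list of fractions -/

namespace RatAutomaton

/-- The transition matrices as lists of rows. -/
def mats (A : RatAutomaton) : List (List (List ℚ)) :=
  List.ofFn fun a => List.ofFn fun i => List.ofFn (A.aut.M a i)

/-- The initial vector, the final vector, and all rows of the transition matrices. -/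
def rows (A : RatAutomaton) : List (List ℚ) :=
  List.ofFn A.aut.α :: List.ofFn A.aut.η :: A.mats.flatten

theorem encodeVec_eq {n : ℕ} (v : Fin n → ℚ) : encodeVec v = (List.ofFn v).flatMap encodeRat := by
  rw [encodeVec, List.flatMap_def, List.map_ofFn]
  rfl

theorem flatten_flatMap {α β : Type*} (l : List (List α)) (f : α → List β) :
    l.flatten.flatMap f = (l.map fun m => m.flatMap f).flatten := by
  induction l with
  | nil => rfl
  | cons m l ih => simp [ih]

theorem encodeMat_eq {n : ℕ} (B : Matrix (Fin n) (Fin n) ℚ) :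
    encodeMat B = (List.ofFn fun i => List.ofFn (B i)).flatten.flatMap encodeRat := by
  rw [encodeMat, flatten_flatMap, List.map_ofFn]
  simp only [encodeVec_eq]
  rfl

theorem encode_eq (A : RatAutomaton) :
    A.encode = encodeUnary A.n ++ encodeUnary A.m ++ A.rows.flatten.flatMap encodeRat := by
  have h : (List.ofFn fun a => encodeMat (A.aut.M a)).flatten =
      A.mats.flatten.flatten.flatMap encodeRat := by
    rw [flatten_flatMap, List.map_flatten, List.flatten_flatten, mats, List.map_ofFn, List.map_ofFn]
    congr 2
    funext a
    rw [encodeMat_eq, flatten_flatMap]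
    rfl
  rw [encode, h, rows, encodeVec_eq, encodeVec_eq]
  simp only [List.flatten_cons, List.flatMap_append, List.append_assoc]

end RatAutomaton

theorem TreeProg.decideToks_encode (A : RatAutomaton) : decideToks (A.encode.map tok) =
    decideEntries (List.replicate A.n true) (A.rows.flatten.map fun q => (q.num, q.den)) := by
  have h : parse (A.encode.map tok) = (false, List.replicate A.n true, []) ::
      (false, List.replicate A.m true, []) :: A.rows.flatten.map fun q => (decide (q < 0),
        (Computability.encodeNat q.num.natAbs).reverse,
        (Computability.encodeNat q.den).reverse) := by
    rw [parse, A.encode_eq]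
    simp only [List.map_append, List.foldl_append, foldl_parseStep_unary, foldl_parseStep_flatMap]
    simp
  rw [decideToks, h]
  simp only [List.headD_cons, List.tail_cons, List.map_map]
  congr 2
  funext q
  exact toEntry_eq q

/-! ### Reduction to short words -/

/-- Let S k be the span of the vectors of words of length at most k. These spans cannot increase
strictly more often than the dimension allows, and each F a maps S k into S (k + 1). Once S k = S (k
+ 1), this space contains the vectors of all words, while φ already vanishes on it. -/
theorem forall_eq_zero_of_short {K V ι : Type*} [Field K] [AddCommGroup V] [Module K V]
    [FiniteDimensional K V] (F : ι → V →ₗ[K] V) (y : V) (φ : V →ₗ[K] K) {N : ℕ}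
    (hN : Module.finrank K V ≤ N)
    (h : ∀ w : List ι, w.length ≤ N → φ (w.foldr (fun a v => F a v) y) = 0) (w : List ι) :
    φ (w.foldr (fun a v => F a v) y) = 0 := by
  let S : ℕ → Submodule K V := fun k =>
    Submodule.span K {v | ∃ w : List ι, w.length ≤ k ∧ w.foldr (fun a v => F a v) y = v}
  have hmono : ∀ k, S k ≤ S (k + 1) := fun k =>
    Submodule.span_mono fun v ⟨w, hw, hv⟩ => ⟨w, by omega, hv⟩
  obtain ⟨k, hk, hS⟩ : ∃ k ≤ Module.finrank K V, S k = S (k + 1) := by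
    by_contra! hne
    have key : ∀ k ≤ Module.finrank K V + 1, k ≤ Module.finrank K (S k) := by
      intro k
      induction k with
      | zero => intro _; exact Nat.zero_le _
      | succ k ih =>
        intro hk
        have := Submodule.finrank_lt_finrank_of_lt
          (lt_of_le_of_ne (hmono k) (hne k (by omega)))
        have := ih (by omega)
        omega
    have h₁ := key _ le_rfl
    have h₂ := Submodule.finrank_le (S (Module.finrank K V + 1))
    omega
  have hmem : ∀ w : List ι, w.foldr (fun a v => F a v) y ∈ S k := by
    intro w
    induction w with
    | nil => exact Submodule.subset_span ⟨[], by simp, rfl⟩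
    | cons a w ih =>
      have hle : S k ≤ (S (k + 1)).comap (F a) := by
        refine Submodule.span_le.2 ?_
        rintro v ⟨w, hw, rfl⟩
        exact Submodule.subset_span ⟨a :: w, by simpa using hw, rfl⟩
      rw [hS]
      exact hle ih
  have hle : S k ≤ LinearMap.ker φ := by
    refine Submodule.span_le.2 ?_
    rintro v ⟨w, hw, rfl⟩
    exact h w (by omega)
  exact hle (hmem w)

namespace WeightedAutomaton

open Matrix

theorem language_eq {F Q S : Type*} [CommSemiring F] [Fintype Q] [DecidableEq Q]
    (A : WeightedAutomaton F Q S) (w : List S) :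
    A.language w = A.α ⬝ᵥ w.foldr (fun a v => A.M a *ᵥ v) A.η := by
  rw [language, ← dotProduct_mulVec]
  congr 1
  induction w with
  | nil => simp [wordMatrix]
  | cons a w ih =>
    rw [List.foldr_cons, ← ih, mulVec_mulVec]
    simp [wordMatrix]

/-- The polynomial L(L - 1) becomes linear on pairs (X, x) with X = x xᵀ: a letter acts by (M X Mᵀ,
M x), and the functional is αᵀXα - α·x. The bound is the dimension n² + n of the space of pairs. -/
theorem isImageBinary_iff_short {F Q S : Type*} [Field F] [Fintype Q] [DecidableEq Q]
    (A : WeightedAutomaton F Q S) {N : ℕ} (hN : Fintype.card Q * Fintype.card Q + Fintype.card Q ≤ N) :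
    A.IsImageBinary ↔ ∀ w : List S, w.length ≤ N → A.language w = 0 ∨ A.language w = 1 := by
  refine ⟨fun h w _ => h w, fun h => ?_⟩
  let G : S → Matrix Q Q F × (Q → F) →ₗ[F] Matrix Q Q F × (Q → F) := fun a =>
    { toFun := fun p => (A.M a * p.1 * (A.M a)ᵀ, A.M a *ᵥ p.2)
      map_add' := fun p q => by simp [mul_add, add_mul, mulVec_add]
      map_smul' := fun c p => by simp [mulVec_smul] }
  let φ : Matrix Q Q F × (Q → F) →ₗ[F] F :=
    { toFun := fun p => A.α ⬝ᵥ (p.1 *ᵥ A.α) - A.α ⬝ᵥ p.2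
      map_add' := fun p q => by simp [add_mulVec, dotProduct_add]; ring
      map_smul' := fun c p => by simp [smul_mulVec, mul_sub] }
  have hG : ∀ w : List S, w.foldr (fun a v => G a v) (vecMulVec A.η A.η, A.η) =
      (vecMulVec (w.foldr (fun a v => A.M a *ᵥ v) A.η) (w.foldr (fun a v => A.M a *ᵥ v) A.η),
        w.foldr (fun a v => A.M a *ᵥ v) A.η) := by
    intro w
    induction w with
    | nil => rfl
    | cons a w ih =>
      rw [List.foldr_cons, ih]
      simp only [List.foldr_cons, G, LinearMap.coe_mk, AddHom.coe_mk]
      rw [mul_vecMulVec, vecMulVec_mul, vecMul_transpose]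
  have hφ : ∀ w : List S, φ (w.foldr (fun a v => G a v) (vecMulVec A.η A.η, A.η)) =
      A.language w * (A.language w - 1) := by
    intro w
    rw [hG, language_eq]
    simp only [φ, LinearMap.coe_mk, AddHom.coe_mk, vecMulVec_mulVec]
    generalize w.foldr (fun a v => A.M a *ᵥ v) A.η = x
    rw [dotProduct_comm x A.α]
    simp
    ring
  intro w
  have := forall_eq_zero_of_short G (vecMulVec A.η A.η, A.η) φ (N := N)
    (by simpa [Module.finrank_matrix] using hN) (fun w hw => by
      rw [hφ, mul_eq_zero, sub_eq_zero]
      exact h w hw) w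
  rwa [hφ, mul_eq_zero, sub_eq_zero] at this

end WeightedAutomaton

namespace TreeProg

/-! ### Correctness of the decision procedure -/

theorem dot_cons (x y : ℤ) (u v : List ℤ) : dot (x :: u) (y :: v) = x * y + dot u v := rfl

theorem dot_append {r u : List ℤ} (h : r.length = u.length) (s v : List ℤ) :
    dot (r ++ s) (u ++ v) = dot r u + dot s v := by
  rw [dot, List.zipWith_append h, List.sum_append]
  rfl

theorem dot_map_mul (c : ℤ) : ∀ u v : List ℤ, dot u (v.map fun x => c * x) = c * dot u v
  | [], v => by simp [dot]
  | x :: u, [] => by simp [dot]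
  | x :: u, y :: v => by
    rw [List.map_cons, dot_cons, dot_cons, dot_map_mul c u v]
    ring

theorem dot_map_mul_left (c : ℤ) : ∀ u v : List ℤ, dot (u.map fun x => c * x) v = c * dot u v
  | [], v => by simp [dot]
  | x :: u, [] => by simp [dot]
  | x :: u, y :: v => by
    rw [List.map_cons, dot_cons, dot_cons, dot_map_mul_left c u v]
    ring

theorem dot_zipWith_add : ∀ u v w : List ℤ, v.length = w.length →
    dot u (List.zipWith (fun x y => x + y) v w) = dot u v + dot u w
  | [], v, w, _ => by simp [dot]
  | x :: u, [], [], _ => by simp [dot]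
  | x :: u, y :: v, z :: w, h => by
    rw [List.zipWith_cons_cons, dot_cons, dot_cons, dot_cons,
      dot_zipWith_add u v w (by simpa using h)]
    ring

theorem length_kronVec (u v : List ℤ) : (kronVec u v).length = u.length * v.length := by
  simp [kronVec, List.length_flatMap]

/-- The mixed-product rule; equal lengths keep the blocks of the two Kronecker products aligned. -/
theorem dot_kronVec {r u s v : List ℤ} (h : r.length = u.length) (h' : s.length = v.length) :
    dot (kronVec r s) (kronVec u v) = dot r u * dot s v := by
  induction r generalizing u with
  | nil =>
    cases u with
    | nil => simp [dot, kronVec]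
    | cons y u => simp at h
  | cons x r ih =>
    cases u with
    | nil => simp at h
    | cons y u =>
      have ih := ih (u := u) (by simpa using h)
      simp only [kronVec, List.flatMap_cons] at ih ⊢
      rw [dot_append (by simpa using h'), ih, dot_map_mul, dot_map_mul_left, dot_cons]
      ring

theorem mulVec_kronMat {A B : List (List ℤ)} {u v : List ℤ} (hA : ∀ r ∈ A, r.length = u.length)
    (hB : ∀ s ∈ B, s.length = v.length) :
    mulVec (kronMat A B) (kronVec u v) = kronVec (mulVec A u) (mulVec B v) := by
  have h : ∀ r ∈ A, (B.map fun s => kronVec r s).map (fun t => dot t (kronVec u v)) =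
      (B.map fun s => dot s v).map fun y => dot r u * y := by
    intro r hr
    rw [List.map_map, List.map_map]
    exact List.map_congr_left fun s hs => dot_kronVec (hA r hr) (hB s hs)
  simp only [mulVec, kronMat, kronVec, List.map_flatMap, List.flatMap_map]
  exact List.flatMap_congr h

theorem length_row_kronMat {A B : List (List ℤ)} {m n : ℕ} (hA : ∀ r ∈ A, r.length = m)
    (hB : ∀ s ∈ B, s.length = n) : ∀ t ∈ kronMat A B, t.length = m * n := by
  intro t ht
  simp only [kronMat, List.mem_flatMap, List.mem_map] at ht
  obtain ⟨r, hr, s, hs, rfl⟩ := ht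
  rw [length_kronVec, hA r hr, hB s hs]

/-- Linear combinations of lists are expressed weakly, through pairings with every ξ. Such an
identity passes to the image under B because the pairings with the rows of B are instances of it. -/
theorem dot_mulVec_of_forall {ι : Type*} {T : List ℤ} {L : List ι} {c : ι → ℤ} {f : ι → List ℤ}
    (h : ∀ ξ, dot ξ T = (L.map fun p => c p * dot ξ (f p)).sum) (B : List (List ℤ)) (ξ : List ℤ) :
    dot ξ (mulVec B T) = (L.map fun p => c p * dot ξ (mulVec B (f p))).sum := by
  induction B generalizing ξ with
  | nil => simp [mulVec, dot]
  | cons r B ih =>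
    cases ξ with
    | nil => simp [dot]
    | cons x ξ =>
      have ih := ih ξ
      simp only [mulVec, List.map_cons, dot_cons] at ih ⊢
      rw [ih, h, ← List.sum_map_mul_left, ← List.sum_map_add]
      congr 1
      refine List.map_congr_left fun p _ => ?_
      ring

/-- The fourth Kronecker power of a vector. -/
def kron4 (u : List ℤ) : List ℤ := kronVec (kronVec u u) (kronVec u u)

/-- The fourth Kronecker power of a matrix. -/
def kronMat4 (A : List (List ℤ)) : List (List ℤ) := kronMat (kronMat A A) (kronMat A A)

theorem length_kron4 (u : List ℤ) : (kron4 u).length = u.length ^ 4 := by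
  rw [kron4, length_kronVec, length_kronVec]
  ring

theorem mulVec_kronMat4 {A : List (List ℤ)} {u : List ℤ} (hA : ∀ r ∈ A, r.length = u.length) :
    mulVec (kronMat4 A) (kron4 u) = kron4 (mulVec A u) := by
  have h := length_row_kronMat hA hA
  rw [kronMat4, kron4, mulVec_kronMat, mulVec_kronMat hA hA, kron4]
  all_goals rwa [length_kronVec]

/-- The fourth power is needed here: it makes the square of a product of two linear forms a linear
functional, so that the values are nonnegative and cannot cancel in a sum. -/
theorem dot_kron4 {u p q : List ℤ} (hp : p.length = u.length) (hq : q.length = u.length) :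
    dot (kronVec (kronVec p q) (kronVec p q)) (kron4 u) = (dot p u * dot q u) ^ 2 := by
  have h : (kronVec p q).length = (kronVec u u).length := by
    rw [length_kronVec, length_kronVec, hp, hq]
  rw [kron4, dot_kronVec h h, dot_kronVec hp hq]
  ring

/-! ### Positive combinations over all short words -/

section Words

variable {ι : Type*} {B : ι → List (List ℤ)} {u : List ℤ}

/-- The product of the matrices along a word, applied to a vector. -/
def wordVec (B : ι → List (List ℤ)) (u : List ℤ) (w : List ι) : List ℤ :=
  w.foldr (fun a v => mulVec (B a) v) u

theorem length_wordVec (hB : ∀ a, (B a).length = u.length) (w : List ι) :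
    (wordVec B u w).length = u.length := by
  cases w with
  | nil => rfl
  | cons a w => simp [wordVec, mulVec, hB]

theorem mulVec_kron4_wordVec (hB : ∀ a, (B a).length = u.length)
    (hB' : ∀ a, ∀ r ∈ B a, r.length = u.length) (a : ι) (w : List ι) :
    mulVec (kronMat4 (B a)) (kron4 (wordVec B u w)) = kron4 (wordVec B u (a :: w)) :=
  mulVec_kronMat4 fun r hr => by rw [hB' a r hr, length_wordVec hB]

theorem length_mulVec_kronMat4 (hB : ∀ a, (B a).length = u.length) (a : ι) (v : List ℤ) :
    (mulVec (kronMat4 (B a)) v).length = u.length ^ 4 := by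
  have : (kronMat4 (B a)).length = (B a).length ^ 4 := by
    simp only [kronMat4, kronMat, List.length_flatMap, List.length_map, List.map_const',
      List.sum_replicate, smul_eq_mul]
    ring
  rw [mulVec, List.length_map, this, hB]

/-- One step of the iteration, on a positive combination of the vectors of words. -/
theorem dot_step (hB : ∀ a, (B a).length = u.length)
    (hB' : ∀ a, ∀ r ∈ B a, r.length = u.length) (c : ℤ) (letters : List ι) {T : List ℤ}
    (hT : T.length = u.length ^ 4) {L : List (ℤ × List ι)}
    (h : ∀ ξ, dot ξ T = (L.map fun p => p.1 * dot ξ (kron4 (wordVec B u p.2))).sum) :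
    (step c (letters.map fun a => kronMat4 (B a)) T).length = u.length ^ 4 ∧
    ∀ ξ, dot ξ (step c (letters.map fun a => kronMat4 (B a)) T) =
      ((L.map (fun p => (c * p.1, p.2)) ++
        letters.flatMap fun a => L.map fun p => (p.1, a :: p.2)).map
          fun p => p.1 * dot ξ (kron4 (wordVec B u p.2))).sum := by
  -- Induction over the letters with an arbitrary accumulator `W`; the vector `T` to which the
  -- matrices are applied stays fixed.
  have key : ∀ (letters : List ι) (W : List ℤ) (L' : List (ℤ × List ι)), W.length = u.length ^ 4 →
      (∀ ξ, dot ξ W = (L'.map fun p => p.1 * dot ξ (kron4 (wordVec B u p.2))).sum) →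
      ((letters.map fun a => kronMat4 (B a)).foldl (fun w B =>
        List.zipWith (fun x y => x + y) w (mulVec B T)) W).length = u.length ^ 4 ∧
      ∀ ξ, dot ξ ((letters.map fun a => kronMat4 (B a)).foldl (fun w B =>
        List.zipWith (fun x y => x + y) w (mulVec B T)) W) = ((L' ++
          letters.flatMap fun a => L.map fun p => (p.1, a :: p.2)).map
            fun p => p.1 * dot ξ (kron4 (wordVec B u p.2))).sum := by
    intro letters
    induction letters with
    | nil => intro W L' hW h'; exact ⟨hW, by simpa using h'⟩
    | cons a letters ih =>
      intro W L' hW h'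
      have hlen := length_mulVec_kronMat4 hB a T
      have := ih (List.zipWith (fun x y => x + y) W (mulVec (kronMat4 (B a)) T))
        (L' ++ L.map fun p => (p.1, a :: p.2)) (by simp [hW, hlen]) (by
          intro ξ
          rw [dot_zipWith_add _ _ _ (hW.trans hlen.symm), h', dot_mulVec_of_forall h]
          simp only [mulVec_kron4_wordVec hB hB', List.map_append, List.map_map, List.sum_append]
          rfl)
      simpa [List.append_assoc] using this
  refine key letters (T.map fun x => c * x) _ (by simpa using hT) fun ξ => ?_
  rw [dot_map_mul, h, ← List.sum_map_mul_left, List.map_map]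
  congr 1
  refine List.map_congr_left fun p _ => ?_
  simp [mul_assoc]

/-- The scalar c > 0 retains the words present before, and the matrices prepend each letter to them.
Hence all words up to length k occur, and no coefficient becomes negative or zero. -/
theorem exists_dot_iterate (hB : ∀ a, (B a).length = u.length)
    (hB' : ∀ a, ∀ r ∈ B a, r.length = u.length) {c : ℤ} (hc : 0 < c) {letters : List ι}
    (hl : ∀ a, a ∈ letters) (k : ℕ) :
    ∃ L : List (ℤ × List ι), (∀ p ∈ L, 0 < p.1) ∧
      (∀ w : List ι, w.length ≤ k → ∃ p ∈ L, p.2 = w) ∧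
      ((step c (letters.map fun a => kronMat4 (B a)))^[k] (kron4 u)).length = u.length ^ 4 ∧
      ∀ ξ, dot ξ ((step c (letters.map fun a => kronMat4 (B a)))^[k] (kron4 u)) =
        (L.map fun p => p.1 * dot ξ (kron4 (wordVec B u p.2))).sum := by
  induction k with
  | zero =>
    refine ⟨[(1, [])], by simp, ?_, length_kron4 u, by simp [wordVec]⟩
    intro w hw
    exact ⟨(1, []), by simp, (List.length_eq_zero_iff.1 (by omega)).symm⟩
  | succ k ih =>
    obtain ⟨L, hpos, hcov, hlen, hdot⟩ := ih
    obtain ⟨h₁, h₂⟩ := dot_step hB hB' c letters hlen hdot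
    refine ⟨_, ?_, ?_, by rw [iterate_succ_apply']; exact h₁,
      by rw [iterate_succ_apply']; exact h₂⟩
    · intro p hp
      simp only [List.mem_append, List.mem_map, List.mem_flatMap] at hp
      rcases hp with ⟨q, hq, rfl⟩ | ⟨a, -, q, hq, rfl⟩
      · exact mul_pos hc (hpos q hq)
      · exact hpos q hq
    · intro w hw
      cases w with
      | nil =>
        obtain ⟨p, hp, hpw⟩ := hcov [] (by simp)
        exact ⟨(c * p.1, p.2), List.mem_append_left _ (List.mem_map.2 ⟨p, hp, rfl⟩), hpw⟩
      | cons a w =>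
        obtain ⟨p, hp, hpw⟩ := hcov w (by simpa using hw)
        refine ⟨(p.1, a :: p.2), List.mem_append_right _ ?_, by simp [hpw]⟩
        exact List.mem_flatMap.2 ⟨a, hl a, List.mem_map.2 ⟨p, hp, rfl⟩⟩

theorem dot_iterateStep_eq_zero_iff (hB : ∀ a, (B a).length = u.length)
    (hB' : ∀ a, ∀ r ∈ B a, r.length = u.length) {c : ℤ} (hc : 0 < c) {letters : List ι}
    (hl : ∀ a, a ∈ letters) {p q : List ℤ} (hp : p.length = u.length) (hq : q.length = u.length)
    (P : Prop) (hP : P → ∀ w, dot p (wordVec B u w) * dot q (wordVec B u w) = 0)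
    (hP' : (∀ w : List ι, w.length ≤ u.length ^ 4 →
      dot p (wordVec B u w) * dot q (wordVec B u w) = 0) → P) :
    dot (kronVec (kronVec p q) (kronVec p q))
      (iterateStep c (letters.map fun a => kronMat4 (B a)) (kron4 u)) = 0 ↔ P := by
  obtain ⟨L, hpos, hcov, -, hdot⟩ := exists_dot_iterate hB hB' hc hl (u.length ^ 4)
  have h₁ : ∀ w, dot (kronVec (kronVec p q) (kronVec p q)) (kron4 (wordVec B u w)) =
      (dot p (wordVec B u w) * dot q (wordVec B u w)) ^ 2 := fun w =>
    dot_kron4 (by rw [hp, length_wordVec hB]) (by rw [hq, length_wordVec hB])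
  -- The number of iterations is the length of the start vector, which is `u.length ^ 4`.
  rw [iterateStep, List.foldl_const, length_kron4, hdot]
  simp only [h₁]
  constructor
  · intro h
    refine hP' fun w hw => ?_
    obtain ⟨x, hx, rfl⟩ := hcov w hw
    have hnn : ∀ y ∈ L.map fun x => x.1 * (dot p (wordVec B u x.2) * dot q (wordVec B u x.2)) ^ 2,
        0 ≤ y := by
      intro y hy
      obtain ⟨x, hx, rfl⟩ := List.mem_map.1 hy
      exact mul_nonneg (hpos x hx).le (sq_nonneg _)
    have h₂ := List.all_zero_of_le_zero_le_of_sum_eq_zero hnn h (List.mem_map.2 ⟨x, hx, rfl⟩)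
    rcases mul_eq_zero.1 h₂ with h₃ | h₃
    · exact absurd h₃ (hpos x hx).ne'
    · exact pow_eq_zero_iff (two_ne_zero) |>.1 h₃
  · intro h
    simp [hP h]

end Words

end TreeProg

/-! ### Integral automata, common denominators and cutting into rows -/

namespace TreeProg

theorem dot_ofFn : ∀ {n : ℕ} (f g : Fin n → ℤ), dot (List.ofFn f) (List.ofFn g) = f ⬝ᵥ g
  | 0, f, g => by simp [dot]
  | n + 1, f, g => by
    rw [List.ofFn_succ, List.ofFn_succ, dot_cons, dot_ofFn]
    simp [dotProduct, Fin.sum_univ_succ]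

theorem dot_map_zero (l v : List ℤ) : dot (l.map fun _ => 0) v = 0 := by
  have := dot_map_mul_left 0 l v
  simpa using this

theorem mulVec_border (D e : ℤ) {z v : List ℤ} {M : List (List ℤ)} (hz : z.length = v.length)
    (hM : ∀ r ∈ M, r.length = v.length) :
    mulVec (border D (z.map fun _ => 0) M) (v ++ [e]) = mulVec M v ++ [D * e] := by
  rw [mulVec, border, List.map_append, List.map_map]
  congr 1
  · refine List.map_congr_left fun r hr => ?_
    simp only [comp]
    rw [dot_append (hM r hr)]
    simp [dot]
  · simp only [List.map_cons, List.map_nil]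
    rw [dot_append (by simpa using hz), dot_map_zero]
    simp [dot]

-- The additional state contributes a power of D that matches the scaling of the other coordinates.
-- Thus pairing with (α, 0) and (α, -D), scaled, gives D^(|w|+2) L(w) and D^(|w|+2) (L(w) - 1).
open Matrix in
theorem core_eq_true_iff {n m : ℕ} (A : WeightedAutomaton ℚ (Fin n) (Fin m)) {D : ℕ} (hD : 0 < D)
    (v w : Fin n → ℤ) (M : Fin m → Matrix (Fin n) (Fin n) ℤ) (hv : ∀ i, (v i : ℚ) = D * A.α i)
    (hw : ∀ i, (w i : ℚ) = D * A.η i) (hM : ∀ a i j, (M a i j : ℚ) = D * A.M a i j) :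
    core D (List.ofFn v) (List.ofFn w) (List.ofFn fun a => List.ofFn fun i => List.ofFn (M a i)) =
      true ↔ A.IsImageBinary := by
  set B : Fin m → List (List ℤ) := fun a => border D ((List.ofFn v).map fun _ => 0)
    (List.ofFn fun i => List.ofFn (M a i))
  have hB : ∀ a, (B a).length = (List.ofFn w ++ [(D : ℤ)]).length := by
    intro a
    simp [B, border]
  have hB' : ∀ a, ∀ r ∈ B a, r.length = (List.ofFn w ++ [(D : ℤ)]).length := by
    intro a r hr
    simp only [B, border, List.mem_append, List.mem_map, List.mem_ofFn] at hr
    rcases hr with ⟨s, ⟨i, rfl⟩, rfl⟩ | hr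
    · simp
    · rw [List.mem_singleton.1 hr]
      simp
  have hword : ∀ l : List (Fin m), ∃ x : Fin n → ℤ,
      wordVec B (List.ofFn w ++ [(D : ℤ)]) l = List.ofFn x ++ [(D : ℤ) ^ (l.length + 1)] ∧
      ∀ i, (x i : ℚ) = D ^ (l.length + 1) * l.foldr (fun a v => A.M a *ᵥ v) A.η i := by
    intro l
    induction l with
    | nil => exact ⟨w, by simp [wordVec], by simpa using hw⟩
    | cons a l ih =>
      obtain ⟨x, hx, hx'⟩ := ih
      refine ⟨M a *ᵥ x, ?_, fun i => ?_⟩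
      · change mulVec (B a) (wordVec B _ l) = _
        rw [hx, mulVec_border _ _ (by simp) (by
          intro r hr
          obtain ⟨i, rfl⟩ := List.mem_ofFn.1 hr
          simp)]
        congr 1
        · rw [mulVec, List.map_ofFn]
          congr 1
          funext i
          exact dot_ofFn _ _
        · rw [List.length_cons, pow_succ' _ (l.length + 1)]
      · simp only [Matrix.mulVec, dotProduct, List.foldr_cons, Int.cast_sum, Int.cast_mul, hM, hx',
          List.length_cons, Finset.mul_sum]
        refine Finset.sum_congr rfl fun j _ => ?_
        ring
  have hX : ∀ l : List (Fin m), ∀ e : ℤ,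
      ((dot (List.ofFn v ++ [e]) (wordVec B (List.ofFn w ++ [(D : ℤ)]) l) : ℤ) : ℚ) =
        D ^ (l.length + 1) * (D * A.language l + e) := by
    intro l e
    obtain ⟨x, hx, hx'⟩ := hword l
    rw [hx, dot_append (by simp), dot_ofFn, A.language_eq]
    simp only [dot, dotProduct, Int.cast_add, Int.cast_sum, Int.cast_mul, hv, hx',
      Finset.mul_sum, mul_add, List.zipWith_cons_cons, List.zipWith_nil_left, List.sum_cons,
      List.sum_nil, add_zero, Int.cast_pow, Int.cast_natCast]
    congr 1
    · refine Finset.sum_congr rfl fun j _ => ?_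
      ring
    · ring
  have hD' : (D : ℚ) ≠ 0 := by exact_mod_cast hD.ne'
  have hiff : ∀ l : List (Fin m),
      dot (List.ofFn v ++ [0]) (wordVec B (List.ofFn w ++ [(D : ℤ)]) l) *
        dot (List.ofFn v ++ [-(D : ℤ)]) (wordVec B (List.ofFn w ++ [(D : ℤ)]) l) = 0 ↔
      A.language l = 0 ∨ A.language l = 1 := by
    intro l
    rw [← Int.cast_eq_zero (α := ℚ), Int.cast_mul, hX, hX]
    have h₁ : (D : ℚ) ^ (l.length + 1) * (D * A.language l + (0 : ℤ)) *
        (D ^ (l.length + 1) * (D * A.language l + (-(D : ℤ) : ℤ))) =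
        D ^ (2 * l.length + 4) * (A.language l * (A.language l - 1)) := by
      push_cast
      ring
    rw [h₁, mul_eq_zero_iff_left (pow_ne_zero _ hD'), mul_eq_zero, sub_eq_zero]
  have hMs : (List.ofFn fun a => List.ofFn fun i => List.ofFn (M a i)) =
      (List.finRange m).map fun a => List.ofFn fun i => List.ofFn (M a i) := List.ofFn_eq_map
  -- Only positivity of the scalar D⁴ matters.
  have key := dot_iterateStep_eq_zero_iff hB hB' (c := (D : ℤ) * D * (D * D)) (by positivity)
    (letters := List.finRange m) (fun a => List.mem_finRange a)
    (p := List.ofFn v ++ [0]) (q := List.ofFn v ++ [-(D : ℤ)]) (by simp) (by simp)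
    A.IsImageBinary (fun h l => (hiff l).2 (h l)) (fun h => by
      -- The number of iterations (n + 1)⁴ exceeds the required length n² + n.
      refine (A.isImageBinary_iff_short (N := (List.ofFn w ++ [(D : ℤ)]).length ^ 4) ?_).2
        fun l hl => (hiff l).1 (h l hl)
      simp only [Fintype.card_fin, List.length_append, List.length_ofFn, List.length_cons,
        List.length_nil, zero_add]
      nlinarith [Nat.zero_le n, Nat.zero_le (n ^ 2), Nat.zero_le (n ^ 3), Nat.zero_le (n ^ 4)])
  rw [core, decide_eq_true_iff, hMs, List.map_map]
  exact key

/-- E is the product of the denominators still to be read: everything already in the state is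
multiplied by it. -/
theorem foldl_scaleStep (l : List ℚ) (s : ℕ × List ℤ) : ∃ E : ℕ, 0 < E ∧
    ((l.map fun q => (q.num, q.den)).foldl scaleStep s).1 = E * s.1 ∧
    ((l.map fun q => (q.num, q.den)).foldl scaleStep s).2.map (Int.cast : ℤ → ℚ) =
      (l.reverse.map fun q : ℚ => (E : ℚ) * (s.1 : ℚ) * q) ++
        s.2.map fun x : ℤ => (E : ℚ) * (x : ℚ) := by
  induction l generalizing s with
  | nil => exact ⟨1, one_pos, by simp, by simp⟩
  | cons q l ih =>
    obtain ⟨E, hE, h₁, h₂⟩ := ih (scaleStep s (q.num, q.den))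
    refine ⟨E * q.den, Nat.mul_pos hE q.den_pos, ?_, ?_⟩
    · rw [List.map_cons, List.foldl_cons, h₁]
      simp only [scaleStep]
      ring
    · rw [List.map_cons, List.foldl_cons, h₂]
      simp only [scaleStep, List.reverse_cons, List.map_append, List.map_cons, List.map_nil,
        List.append_assoc, List.map_map, List.cons_append, List.nil_append]
      congr 1
      · refine List.map_congr_left fun r _ => ?_
        push_cast
        ring
      · congr 1
        · have := Rat.mul_den_eq_num q
          push_cast
          rw [← this]
          ring
        · refine List.map_congr_left fun r _ => ?_
          simp only [comp]
          push_cast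
          ring

/-- Describing the scaled entries by one function g of the rational value makes scaling a
`List.map`, which commutes with flattening and hence with cutting into rows. -/
theorem scale_eq (l : List ℚ) : ∃ (D : ℕ) (g : ℚ → ℤ), 0 < D ∧
    (scale (l.map fun q => (q.num, q.den))).1 = D ∧
    (scale (l.map fun q => (q.num, q.den))).2.reverse = l.map g ∧ ∀ q ∈ l, (g q : ℚ) = D * q := by
  obtain ⟨D, hD, h₁, h₂⟩ := foldl_scaleStep l (1, [])
  rw [scale]
  generalize (l.map fun q => (q.num, q.den)).foldl scaleStep (1, []) = s at *
  simp only [mul_one, Nat.cast_one, List.map_nil, List.append_nil] at h₁ h₂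
  -- For q in the list, D q is an integer, so its numerator is its value.
  refine ⟨D, fun q => (D * q : ℚ).num, hD, h₁, ?_, ?_⟩
  · have h₃ := congrArg (List.map Rat.num) h₂
    rw [List.map_map, List.map_map] at h₃
    have h₄ : Rat.num ∘ (Int.cast : ℤ → ℚ) = id := by
      funext x
      simp
    rw [h₄, List.map_id] at h₃
    rw [h₃, ← List.map_reverse, List.reverse_reverse]
    rfl
  · intro q hq
    have h₃ : (D * q : ℚ) ∈ s.2.map (Int.cast : ℤ → ℚ) := by
      rw [h₂]
      exact List.mem_map.2 ⟨q, List.mem_reverse.2 hq, rfl⟩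
    obtain ⟨x, -, hx⟩ := List.mem_map.1 h₃
    simp only [← hx, Rat.num_intCast]

/-- The list `fuel` only counts steps; once the input is exhausted, further steps change nothing. -/
theorem foldl_chunkStep {β γ δ : Type} (n : List γ) (hn : n ≠ []) (L : List (List β))
    (hL : ∀ r ∈ L, r.length = n.length) (acc : List (List β)) (fuel : List δ)
    (hf : L.length ≤ fuel.length) :
    (fuel.foldl (fun s _ => chunkStep n s) (L.flatten, acc)).2 = L.reverse ++ acc := by
  induction fuel generalizing L acc with
  | nil =>
    cases L with
    | nil => rfl
    | cons r L => simp at hf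
  | cons x fuel ih =>
    cases L with
    | nil => exact ih [] (by simp) acc (by simp)
    | cons r L =>
      have hr := hL r (by simp)
      have hne : (r ++ L.flatten).isEmpty = false := by
        cases r with
        | nil => exact absurd (List.length_eq_zero_iff.1 hr.symm) hn
        | cons y r => rfl
      have h₁ : chunkStep n ((r :: L).flatten, acc) = (L.flatten, r :: acc) := by
        rw [List.flatten_cons, chunkStep]
        simp only [hne, cond_false, takeAs_eq, dropAs_eq, ← hr, List.drop_left, List.take_left]
      rw [List.foldl_cons, h₁, ih L (fun s hs => hL s (by simp [hs])) _ (by simpa using hf)]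
      simp

theorem chunk_flatten {β γ : Type} (n : List γ) (hn : n ≠ []) (L : List (List β))
    (hL : ∀ r ∈ L, r.length = n.length) : chunk n L.flatten = L := by
  -- As the rows are nonempty, the flattened list is long enough to serve as its own step counter.
  have hlen : L.length ≤ L.flatten.length := by
    have h₁ : 1 ≤ n.length := List.length_pos_iff.2 hn
    clear hn
    induction L with
    | nil => simp
    | cons r L ih =>
      have := ih fun s hs => hL s (by simp [hs])
      have := hL r (by simp)
      simp only [List.length_cons, List.flatten_cons, List.length_append]
      omega
  rw [chunk, foldl_chunkStep n hn L hL [] _ hlen]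
  simp

end TreeProg

open TreeProg in
theorem RatAutomaton.decideEntries_eq_true_iff (A : RatAutomaton) :
    decideEntries (List.replicate A.n true) (A.rows.flatten.map fun q => (q.num, q.den)) = true ↔
      A.aut.IsImageBinary := by
  obtain ⟨n, m, A⟩ := A
  obtain ⟨D, g, hD, h₁, h₂, hg⟩ := scale_eq (RatAutomaton.rows ⟨n, m, A⟩).flatten
  rw [decideEntries, h₁, h₂]
  -- Without states, rows are empty and cannot be recovered by cutting. But then there are no
  -- entries, the language is zero, and the procedure evaluates to `true`.
  rcases Nat.eq_zero_or_pos n with rfl | hn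
  · have h₃ : (RatAutomaton.rows ⟨0, m, A⟩).flatten = [] := by
      simp [RatAutomaton.rows, RatAutomaton.mats]
    have h₄ : A.IsImageBinary := by
      intro w
      left
      simp [WeightedAutomaton.language, dotProduct]
    simp only [h₄, iff_true]
    rw [h₃] at h₁ ⊢
    change 1 = D at h₁
    subst h₁
    rfl
  · have hn' : List.replicate n true ≠ [] := by simpa using hn.ne'
    have h₃ : chunk (List.replicate n true) ((RatAutomaton.rows ⟨n, m, A⟩).flatten.map g) =
        (RatAutomaton.rows ⟨n, m, A⟩).map (List.map g) := by
      rw [List.map_flatten]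
      refine chunk_flatten _ hn' _ ?_
      intro r' hr'
      obtain ⟨r, hr, rfl⟩ := List.mem_map.1 hr'
      simp only [RatAutomaton.rows, RatAutomaton.mats, List.mem_cons, List.mem_flatten,
        List.mem_ofFn] at hr
      rcases hr with rfl | rfl | ⟨s, ⟨a, rfl⟩, hr⟩
      · simp
      · simp
      · obtain ⟨i, rfl⟩ := List.mem_ofFn.1 hr
        simp
    have h₄ : chunk (List.replicate n true)
        ((RatAutomaton.mats ⟨n, m, A⟩).flatten.map (List.map g)) =
        (RatAutomaton.mats ⟨n, m, A⟩).map (List.map (List.map g)) := by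
      rw [List.map_flatten]
      refine chunk_flatten _ hn' _ ?_
      intro r' hr'
      obtain ⟨r, hr, rfl⟩ := List.mem_map.1 hr'
      obtain ⟨i, rfl⟩ := List.mem_ofFn.1 hr
      simp
    rw [h₃]
    simp only [RatAutomaton.rows, List.map_cons, List.headD_cons, List.tail_cons]
    rw [h₄]
    simp only [RatAutomaton.mats, List.map_ofFn]
    have hmem : ∀ r ∈ RatAutomaton.rows ⟨n, m, A⟩, ∀ q ∈ r, (g q : ℚ) = D * q :=
      fun r hr q hq => hg q (List.mem_flatten.2 ⟨r, hr, hq⟩)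
    have key := core_eq_true_iff A hD (fun i => g (A.α i)) (fun i => g (A.η i))
      (fun a i j => g (A.M a i j))
      (fun i => hmem _ (by simp [RatAutomaton.rows]) _ (List.mem_ofFn.2 ⟨i, rfl⟩))
      (fun i => hmem _ (List.mem_cons_of_mem _ List.mem_cons_self) _ (List.mem_ofFn.2 ⟨i, rfl⟩))
      (fun a i j => hmem _ (List.mem_cons_of_mem _ (List.mem_cons_of_mem _
        (List.mem_flatten.2 ⟨_, List.mem_ofFn.2 ⟨a, rfl⟩, List.mem_ofFn.2 ⟨i, rfl⟩⟩)))
        _ (List.mem_ofFn.2 ⟨j, rfl⟩))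
    convert key using 3
    all_goals simp only [comp_def, List.map_ofFn]

/-! ### The machine -/

namespace TreeProg

open StackProg Reg TreeEncodable

/-- Read the input into a tree that represents the list of tokens, in reverse order. -/
def load : Prog := loop inp fun x => seq (pushTree (enc (tok x))) (push main true)

theorem size_tok (x : RatAutomaton.Sym) : (enc (tok x)).size = 17 := by
  obtain ⟨a, b, c⟩ := tok x
  change size (a, b, c) = 17
  simp

theorem size_toks (l : List (Bool × Bool × Bool)) : size l = 18 * l.length + 1 := by
  induction l with
  | nil => rfl
  | cons t l ih =>
    obtain ⟨a, b, c⟩ := t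
    simp only [size_cons, size_pair, size_bool, ih, List.length_cons]
    omega

theorem exec_load (l : List RatAutomaton.Sym) : ∀ m : List (Bool × Bool × Bool),
    Exec load (regs l (enc m).code [] [] []) (19 * l.length + 1)
      (regs [] (enc ((l.map tok).reverse ++ m)).code [] [] []) := by
  induction l with
  | nil => exact fun m => .loop_nil rfl (by simp)
  | cons x l ih =>
    intro m
    have h₁ : Exec (seq (pushTree (enc (tok x))) (push main true) : Prog)
        (regs l (enc m).code [] [] []) 18 (regs l (enc (tok x :: m)).code [] [] []) :=
      .seq (exec_pushTree _ _) (exec_push_main true) (by rw [size_tok])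
    have h₂ := Exec.loop_cons (k := inp) (s := regs (x :: l) (enc m).code [] [] []) rfl
      (by rwa [update_inp]) (ih (tok x :: m)) (le_refl _)
    simpa [load] using h₂.mono (m := 19 * (x :: l).length + 1) (by simp only [List.length_cons]; omega)

/-- Replace the tree of a truth value by the truth value itself. -/
def emit : Prog := case main fun _ => case main fun x => x.elim skip fun b =>
  bif b then drop.seq (drop.seq (drop.seq (push main true))) else drop.seq (push main false)

theorem exec_emit (b : Bool) : Exec emit (config [enc b]) 40 (regs [] [b] [] [] []) := by
  cases b
  · have h : Exec (drop.seq (push main false)) (regs [] [true, false, false] [] [] []) 38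
        (regs [] [false] [] [] []) :=
      .seq (runs_drop (x := .cons .nil .nil) (xs := [])) (exec_push_main false) (by simp)
    exact (exec_case_main (x := true) (exec_case_main (x := false) h)).mono (by omega)
  · have h : Exec (drop.seq (drop.seq (drop.seq (push main true))))
        (regs [] [false, false, false] [] [] []) 38 (regs [] [true] [] [] []) :=
      .seq (runs_drop (x := .nil) (xs := [.nil, .nil])) (.seq (runs_drop (x := .nil) (xs := [.nil]))
        (.seq (runs_drop (x := .nil) (xs := [])) (exec_push_main true) le_rfl) le_rfl) (by simp)
    exact (exec_case_main (x := true) (exec_case_main (x := true) h)).mono (by omega)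

instance : ∀ k, Fintype (Alphabet k)
  | .inp => inferInstanceAs (Fintype RatAutomaton.Sym)
  | .main => inferInstanceAs (Fintype Bool)
  | .aux => inferInstanceAs (Fintype Bool)
  | .tmp => inferInstanceAs (Fintype Bool)
  | .cnt => inferInstanceAs (Fintype Bool)

/-- Polynomial time functions of the tokens of the input are computable by a machine. -/
theorem PolyTime.nonempty_computable {ι : Type} {e : ι → List RatAutomaton.Sym}
    {f : List (Bool × Bool × Bool) → Bool} (hf : PolyTime f) :
    Nonempty (TM2ComputableInPolyTime e Computability.encodeBool fun a => f ((e a).map tok)) := by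
  -- Loading pushes the tokens one at a time and so reverses their order; composing with `reverse`
  -- restores it.
  obtain ⟨-, P, t, ⟨p, hp⟩, hP⟩ := hf.comp (list_reverse PolyTime.id)
  refine StackProg.nonempty_computable (K := Reg) (Γ := Alphabet)
    -- The first symbol pushed is the code of the empty list. The time is 1 for this push, 19ℓ + 1
    -- for loading, the time of `P` on a tree of size 18ℓ + 1, and 40 for the output.
    ((push main false).seq (load.seq (P.seq emit))) inp main (Equiv.refl _) (Equiv.refl _)
    (.C 19 * .X + p.comp (.C 18 * .X + .C 1) + .C 42) fun a => ?_
  have h₀ : update (fun k => ([] : List (Alphabet k))) inp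
      ((e a).map (Equiv.refl (Alphabet inp)).symm) =
      regs (e a) [] [] [] [] := by
    funext k
    cases k <;> simp [regs]
  have h₁ : update (fun k => ([] : List (Alphabet k))) main
      ((Computability.encodeBool (f ((e a).map tok))).map (Equiv.refl (Alphabet main)).symm) =
      regs [] [f ((e a).map tok)] [] [] [] := by
    funext k
    cases k <;> simp [regs, Computability.encodeBool]
  refine Eq.mpr (congrArg₂ (fun s s' => Exec _ s _ s') h₀ h₁) ?_
  have h₂ := exec_load (e a) []
  rw [List.append_nil] at h₂
  have h₃ := hP ((e a).map tok).reverse []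
  simp only [List.reverse_reverse] at h₃
  have h₄ := hp ((e a).map tok).reverse
  rw [size_toks, List.length_reverse, List.length_map] at h₄
  have h₅ : Exec P (regs [] (enc ((e a).map tok).reverse).code [] [] [])
      (t ((e a).map tok).reverse) (config [enc (f ((e a).map tok))]) := by
    simpa [Runs, config] using h₃
  refine .seq (exec_push_main false) (.seq h₂ (.seq h₅ (exec_emit _) le_rfl) le_rfl) ?_
  simp only [Polynomial.eval_add, Polynomial.eval_mul, Polynomial.eval_C, Polynomial.eval_X,
    Polynomial.eval_comp]
  omega

end TreeProg

theorem mainTheorem3 :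
    ∃ isIFA : RatAutomaton → Bool,
      (∀ A : RatAutomaton, isIFA A = true ↔ A.aut.IsImageBinary) ∧
      Nonempty (Turing.TM2ComputableInPolyTime RatAutomaton.encode Computability.encodeBool
        isIFA) := by
  refine ⟨fun A => TreeProg.decideToks (A.encode.map TreeProg.tok), fun A => ?_,
    TreeProg.PolyTime.decideToks.nonempty_computable⟩
  change TreeProg.decideToks (A.encode.map TreeProg.tok) = true ↔ _
  rw [TreeProg.decideToks_encode, A.decideEntries_eq_true_iff]
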